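/- For a polynomial $p(x)=a_nx^n+\dots+a_0$ of degree $n$ with integer coefficients let $H(p)=\max_{0\le i\le n}|a_i|$. The degree and the height of an algebraic number $\alpha$ are the degree and the height $H(p)$ of its minimal polynomial $p\in\mathbb Z[x]$, i.e. of a nonzero polynomial of least degree with $p(\alpha)=0$ and with coefficients whose greatest common divisor is $1$. For $S\subseteq\mathbb R$ and $Q>1$ let $\Phi_n(Q,S)$ be the number of algebraic numbers in $S$ of degree $n$ and height at most $Q$. Put $\ell(2)=1$ and $\ell(n)=0$ for $n\ge 3$, and let $\zeta$ be the Riemann zeta function. **Theorem 1.** Let $n\ge 2$. There is a continuous, positive function $\phi_n:\mathbb R\to\mathbb R$, integrable over $\mathbb R$, such that the following hold. 1. For all intervals $I\subseteq\mathbb R$, bounded or unbounded, and all real $Q\ge 2$, $$\Phi_n(Q,I)=\frac{Q^{n+1}}{2\zeta(n+1)}\int_I\phi_n(x)\,dx+O\!\left(Q^n(\ln Q)^{\ell(n)}\right),$$ where the implicit constant depends only on $n$. 2. For infinitely many families of intervals $I=I(Q)$ the true order of the remainder term is $Q^n$ as $Q\to\infty$. Precisely, for every $x_0\in\mathbb Q$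 there are intervals $I(Q)=[x_0-r(Q),x_0+r(Q)]$ with $r(Q)>0$ and constants $c_1,c_2>0$ such that for all sufficiently large $Q$ $$c_1Q^n\le\left|\Phi_n(Q,I(Q))-\frac{Q^{n+1}}{2\zeta(n+1)}\int_{I(Q)}\phi_n(x)\,dx\right|\le c_2Q^n .$$ 3. $\phi_n(-x)=\phi_n(x)$ for all $x\in\mathbb R$, and $x^2\phi_n(x)=\phi_n(1/x)$ for all $x\ne 0$. 4. For all $t\in\mathbb R$, $$\phi_n(t)=\int_{\Delta_n(t)}\left|\sum_{k=1}^n k\,p_k\,t^{k-1}\right|dp_1\cdots dp_n,$$ where $\Delta_n(t)=\left\{(p_1,\dots,p_n)\in\mathbb R^n:\ \max_{1\le i\le n}|p_i|\le 1,\ |p_nt^n+\dots+p_1t|\le 1\right\}$. 5. For every $x\in\mathbb R$ the limit $$F_n(x)=\lim_{Q\to\infty}\frac{\Phi_n(Q,(-\infty,x])}{\Phi_n(Q,\mathbb R)}$$ exists, the distribution function $F_n$ is continuously differentiable, and $F_n'(x)=\phi_n(x)\big/\int_{\mathbb R}\phi_n(y)\,dy$ for all $x$. -/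

import Mathlib

open MeasureTheory Filter Topology

noncomputable section

namespace RealAlgebraic

/-- The naive height of an integral polynomial: the maximum of the absolute values of its
coefficients. -/
def height (p : Polynomial ℤ) : ℕ := p.support.sup fun i => (p.coeff i).natAbs

/-- `p` is a minimal polynomial of `α` over the integers: a nonzero integral polynomial that
vanishes at `α`, has the least possible degree, and whose coefficients have greatest common
divisor `1`. (It is unique up to sign, and degree and height do not depend on the sign.) -/
def IsMinimalPolynomial (p : Polynomial ℤ) (α : ℝ) : Prop :=
  p ≠ 0 ∧ Polynomial.aeval α p = 0 ∧
    (∀ q : Polynomial ℤ, q ≠ 0 → Polynomial.aeval α q = 0 → p.natDegree ≤ q.natDegree) ∧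
    p.IsPrimitive

/-- The real algebraic numbers of degree `n` and height at most `Q`. -/
def algebraicNumbers (n : ℕ) (Q : ℝ) : Set ℝ :=
  {α | ∃ p : Polynomial ℤ, IsMinimalPolynomial p α ∧ p.natDegree = n ∧ (height p : ℝ) ≤ Q}

/-- The set that is counted below is finite. -/
theorem finite_algebraicNumbers (n : ℕ) (Q : ℝ) : (algebraicNumbers n Q).Finite := by
  refine (Polynomial.bUnion_roots_finite (algebraMap ℤ ℝ) n
    (Set.finite_Icc (-(⌊Q⌋₊ : ℤ)) ⌊Q⌋₊)).subset ?_
  rintro α ⟨p, ⟨hp, hα, -, -⟩, hn, hQ⟩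
  simp only [Set.mem_iUnion]
  refine ⟨p, ⟨hn.le, fun i => ?_⟩, ?_⟩
  · have h : (p.coeff i).natAbs ≤ ⌊Q⌋₊ := by
      by_cases hi : i ∈ p.support
      · exact (Finset.le_sup (f := fun i => (p.coeff i).natAbs) hi).trans (Nat.le_floor hQ)
      · simp [Polynomial.notMem_support_iff.mp hi]
    rw [Set.mem_Icc]
    omega
  · have h0 : p.map (algebraMap ℤ ℝ) ≠ 0 := by
      rwa [Polynomial.map_ne_zero_iff (algebraMap ℤ ℝ).injective_int]
    rw [SetLike.mem_coe, Multiset.mem_toFinset, Polynomial.mem_roots h0, Polynomial.IsRoot,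
      Polynomial.eval_map_algebraMap]
    exact hα

/-- The counting function: the number of real algebraic numbers of degree `n` and height at
most `Q` that lie in `S`. -/
def count (n : ℕ) (Q : ℝ) (S : Set ℝ) : ℕ := (algebraicNumbers n Q ∩ S).ncard

/-- The exponent of the logarithm (only used for `2 ≤ n`). -/
def ell (n : ℕ) : ℕ := if n = 2 then 1 else 0

/-- The region of integration in the explicit formula for the density; the coordinate `p k` with
`k : Fin n` is the coefficient of `t ^ (k + 1)`. -/
def region (n : ℕ) (t : ℝ) : Set (Fin n → ℝ) :=
  {p | (∀ k, |p k| ≤ 1) ∧ |∑ k, p k * t ^ ((k : ℕ) + 1)| ≤ 1}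

/-- The remainder of the counting function with respect to a density `φ`. -/
def remainder (n : ℕ) (φ : ℝ → ℝ) (Q : ℝ) (I : Set ℝ) : ℝ :=
  (count n Q I : ℝ) - Q ^ (n + 1) / (2 * (riemannZeta ((n : ℂ) + 1)).re) * ∫ x in I, φ x

end RealAlgebraic

end

/-! A real algebraic number of degree `n ≥ 2` is a root of exactly two irreducible integral
polynomials, `p` and `-p` (`two_mul_count`). So twice the count is the number of roots in `I`,
summed over the irreducible polynomials of degree `n` and height at most `Q`. Passing from
irreducible to primitive polynomials adds those with vanishing leading coefficient, `O(Q ^ n)` many,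
and reducible ones. Heights are multiplicative up to constants, by comparison with the Mahler
measure, and this bounds the reducible ones by the stated error; the logarithm for `n = 2` is a
harmonic sum (`exists_card_reducibleBox_le`). Möbius inversion over the content then passes from
primitive vectors to all integer vectors and produces the factor `1 / ζ(n + 1)`.

It remains to compare a sum over integer vectors with an integral
(`abs_sum_cubeCount_sub_integral_le`). If all coefficients but one are fixed, vanishing at `t ≠ 0`
determines the remaining coefficient as a function of `t`, which is injective between its critical
points. Hence along every coordinate line the root count is a sum of at most `2 * n + 3` indicators
of intervals, whatever the interval `I`. Shifting one coordinate by an amount in `[0, 1]` changes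
the sum over a line by `O(1)`, so shifting all of them changes the whole sum by `O(Q ^ n)`,
uniformly in `I`. Averaging over the shifts in the unit cube turns the sum into an integral.
Integration in the constant coefficient is a change of variables on each injective branch and gives
the Kac–Rice integral of `|P'(t)|` over `I`; Fubini and scaling then give `Q ^ (n + 1)` times the
integral of `density n`.

The symmetries of the density come from `P(-x)` and `x ^ n P(1 / x)`; the second also gives decay
like `x ^ (-2)`, hence integrability. The remainder is sharp because of Liouville's inequality: no
number being counted lies within `c / (Q + 1)` of a given rational, while the main term on that
interval has order `Q ^ n`. The distribution function is obtained by dividing two instances of the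
asymptotic formula. -/

noncomputable section

namespace RealAlgebraic

/-! ### The density -/

/-- The value at `t` of the polynomial without constant term with coefficients `p`. -/
def tailEval {n : ℕ} (p : Fin n → ℝ) (t : ℝ) : ℝ := ∑ k : Fin n, p k * t ^ ((k : ℕ) + 1)

/-- The derivative at `t` of the polynomial without constant term with coefficients `p`. -/
def tailDeriv {n : ℕ} (p : Fin n → ℝ) (t : ℝ) : ℝ := ∑ k : Fin n, ((k : ℝ) + 1) * p k * t ^ (k : ℕ)

open Classical in
/-- The Kac–Rice integrand for polynomials with coefficients in `[-Q, Q]`. -/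
def kernel {n : ℕ} (Q : ℝ) (p : Fin n → ℝ) (t : ℝ) : ℝ :=
  if (∀ k, |p k| ≤ Q) ∧ |tailEval p t| ≤ Q then |tailDeriv p t| else 0

/-- The density of the real algebraic numbers of degree `n`. -/
def density (n : ℕ) (t : ℝ) : ℝ := ∫ p : Fin n → ℝ, kernel 1 p t

section density

variable {n : ℕ}

theorem continuous_tailEval : Continuous fun x : (Fin n → ℝ) × ℝ => tailEval x.1 x.2 := by
  unfold tailEval; fun_prop

theorem continuous_tailDeriv : Continuous fun x : (Fin n → ℝ) × ℝ => tailDeriv x.1 x.2 := by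
  unfold tailDeriv; fun_prop

theorem kernel_nonneg (Q : ℝ) (p : Fin n → ℝ) (t : ℝ) : 0 ≤ kernel Q p t := by
  unfold kernel; split_ifs <;> positivity

theorem measurable_kernel (Q : ℝ) :
    Measurable fun x : (Fin n → ℝ) × ℝ => kernel Q x.1 x.2 := by
  unfold kernel
  refine Measurable.ite ?_ continuous_tailDeriv.abs.measurable measurable_const
  have h : IsClosed {x : (Fin n → ℝ) × ℝ | (∀ k, |x.1 k| ≤ Q) ∧ |tailEval x.1 x.2| ≤ Q} := by
    rw [Set.ofPred_and, Set.ofPred_forall]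
    refine (isClosed_iInter fun k => isClosed_le (by fun_prop) continuous_const).inter
      (isClosed_le continuous_tailEval.abs continuous_const)
  exact h.measurableSet

theorem density_eq (n : ℕ) (t : ℝ) : density n t = ∫ p in region n t,
    |∑ k : Fin n, ((k : ℝ) + 1) * p k * t ^ (k : ℕ)| := by
  have h : MeasurableSet (region n t) := by
    have : IsClosed (region n t) := by
      unfold region
      rw [Set.ofPred_and, Set.ofPred_forall]
      refine (isClosed_iInter fun k => isClosed_le (by fun_prop) continuous_const).inter
        (isClosed_le (by fun_prop) continuous_const)
    exact this.measurableSet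
  rw [← integral_indicator h, density]
  congr 1 with p
  classical
  rw [Set.indicator_apply, kernel]
  exact if_congr Iff.rfl rfl rfl

theorem abs_tailDeriv_le {Q t T : ℝ} {p : Fin n → ℝ} (hp : ∀ k, |p k| ≤ Q) (ht : |t| ≤ T) :
    |tailDeriv p t| ≤ Q * ∑ k : Fin n, ((k : ℝ) + 1) * T ^ (k : ℕ) := by
  unfold tailDeriv
  rw [Finset.mul_sum]
  refine (Finset.abs_sum_le_sum_abs _ _).trans (Finset.sum_le_sum fun k _ => ?_)
  rw [abs_mul, abs_mul, abs_pow, abs_of_nonneg (by positivity : (0 : ℝ) ≤ (k : ℝ) + 1)]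
  have := pow_le_pow_left₀ (abs_nonneg t) ht k
  have h0 : 0 ≤ |p k| := abs_nonneg _
  calc ((k : ℝ) + 1) * |p k| * |t| ^ (k : ℕ) ≤ ((k : ℝ) + 1) * Q * T ^ (k : ℕ) := by
        gcongr
        · exact mul_nonneg (by positivity) (h0.trans (hp k))
        · exact hp k
    _ = _ := by ring

/-- The cube that contains the support of the kernel. -/
def cube (n : ℕ) (Q : ℝ) : Set (Fin n → ℝ) := Set.Icc (fun _ => -Q) fun _ => Q

theorem mem_cube {Q : ℝ} {p : Fin n → ℝ} : p ∈ cube n Q ↔ ∀ k, |p k| ≤ Q := by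
  simp [cube, Set.mem_Icc, Pi.le_def, abs_le, forall_and]

theorem kernel_le_indicator {Q t T : ℝ} (p : Fin n → ℝ) (ht : |t| ≤ T) :
    kernel Q p t ≤ (cube n Q).indicator
      (fun _ => Q * ∑ k : Fin n, ((k : ℝ) + 1) * T ^ (k : ℕ)) p := by
  classical
  rw [Set.indicator_apply]
  unfold kernel
  by_cases hp : ∀ k, |p k| ≤ Q
  · rw [if_pos (mem_cube.2 hp)]
    have := abs_tailDeriv_le hp ht
    split_ifs
    · exact this
    · exact (abs_nonneg _).trans this
  · rw [if_neg (fun h => hp (mem_cube.1 h)), if_neg (fun h => hp h.1)]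

theorem integrable_cube_indicator (Q c : ℝ) :
    Integrable ((cube n Q).indicator fun _ => c) := by
  rw [integrable_indicator_iff (by exact measurableSet_Icc)]
  exact integrableOn_const (isCompact_Icc.measure_lt_top.ne)

theorem integrable_kernel (Q t : ℝ) : Integrable fun p : Fin n → ℝ => kernel Q p t := by
  refine (integrable_cube_indicator Q (Q * ∑ k : Fin n, ((k : ℝ) + 1) * |t| ^ (k : ℕ))).mono'
    ((measurable_kernel Q).comp (measurable_id.prodMk measurable_const)).aestronglyMeasurable
    (ae_of_all _ fun p => ?_)
  rw [Real.norm_of_nonneg (kernel_nonneg _ _ _)]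
  exact kernel_le_indicator p le_rfl

theorem kernel_smul {Q : ℝ} (hQ : 0 < Q) (p : Fin n → ℝ) (t : ℝ) :
    kernel Q (Q • p) t = Q * kernel 1 p t := by
  have h1 : tailEval (Q • p) t = Q * tailEval p t := by
    simp [tailEval, Finset.mul_sum, mul_assoc]
  have h2 : tailDeriv (Q • p) t = Q * tailDeriv p t := by
    simp only [tailDeriv, Finset.mul_sum, Pi.smul_apply, smul_eq_mul]
    exact Finset.sum_congr rfl fun k _ => by ring
  have h3 : ∀ x : ℝ, |Q * x| ≤ Q ↔ |x| ≤ 1 := fun x => by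
    rw [abs_mul, abs_of_pos hQ, mul_le_iff_le_one_right hQ]
  unfold kernel
  simp only [h1, h2, h3, Pi.smul_apply, smul_eq_mul, abs_mul Q (tailDeriv p t), abs_of_pos hQ,
    mul_ite, mul_zero]

/-- Scaling the coefficients by `Q` has Jacobian `Q ^ n`, and the derivative in the integrand
contributes one more factor `Q`. -/
theorem integral_kernel {Q : ℝ} (hQ : 0 < Q) (t : ℝ) :
    ∫ p : Fin n → ℝ, kernel Q p t = Q ^ (n + 1) * density n t := by
  have h := Measure.integral_comp_smul (volume : Measure (Fin n → ℝ)) (fun p => kernel Q p t) Q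
  simp only [kernel_smul hQ, Module.finrank_fin_fun, integral_const_mul, smul_eq_mul] at h
  rw [abs_of_pos (by positivity)] at h
  rw [pow_succ, mul_assoc, density, h, ← mul_assoc, mul_inv_cancel₀ (by positivity), one_mul]

theorem density_nonneg (t : ℝ) : 0 ≤ density n t :=
  integral_nonneg fun _ => kernel_nonneg _ _ _

/-- The set is an affine subspace, and it is proper because it misses the origin when `c ≠ 0`. -/
theorem volume_tailEval_eq (t : ℝ) {c : ℝ} (hc : c ≠ 0) :
    volume {p : Fin n → ℝ | tailEval p t = c} = 0 := by
  let l : (Fin n → ℝ) →ₗ[ℝ] ℝ := ∑ k : Fin n, (t ^ ((k : ℕ) + 1)) • LinearMap.proj k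
  have hl : ∀ p, l p = tailEval p t := fun p => by
    simp [l, tailEval, mul_comm]
  let s : AffineSubspace ℝ (Fin n → ℝ) := (affineSpan ℝ {c}).comap l.toAffineMap
  have hs : (s : Set (Fin n → ℝ)) = {p | tailEval p t = c} := by
    ext p; simp [s, hl]
  rw [← hs]
  refine Measure.addHaar_affineSubspace _ s fun h => hc ?_
  have : (0 : Fin n → ℝ) ∈ (s : Set (Fin n → ℝ)) := by rw [h]; trivial
  rw [hs] at this
  simpa [tailEval] using this.symm

theorem continuousAt_kernel {p : Fin n → ℝ} {t : ℝ} (h : |tailEval p t| ≠ 1) :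
    ContinuousAt (fun x => kernel 1 p x) t := by
  have hE : Continuous fun x => |tailEval p x| :=
    (continuous_tailEval.comp (continuous_const.prodMk continuous_id)).abs
  have hD : Continuous fun x => |tailDeriv p x| :=
    (continuous_tailDeriv.comp (continuous_const.prodMk continuous_id)).abs
  by_cases hp : ∀ k, |p k| ≤ 1
  · rcases lt_or_gt_of_ne h with h | h
    · refine hD.continuousAt.congr ?_
      filter_upwards [hE.continuousAt.eventually_lt_const h] with x hx
      rw [kernel, if_pos ⟨hp, hx.le⟩]
    · refine (continuousAt_const (y := (0 : ℝ))).congr ?_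
      filter_upwards [hE.continuousAt.eventually_const_lt h] with x hx
      rw [kernel, if_neg (fun H => hx.not_ge H.2)]
  · have : (fun x => kernel 1 p x) = fun _ => 0 := by
      ext x; rw [kernel, if_neg (fun H => hp H.1)]
    rw [this]; exact continuousAt_const

/-- Dominated convergence: the kernel jumps in `t` only if `tailEval p t = ±1`, and for fixed `t`
these `p` form a null set. -/
theorem continuous_density (n : ℕ) : Continuous (density n) := by
  refine continuous_iff_continuousAt.2 fun t => ?_
  refine continuousAt_of_dominated (bound := (cube n 1).indicator
      (fun _ => 1 * ∑ k : Fin n, ((k : ℝ) + 1) * (|t| + 1) ^ (k : ℕ)))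
    (Eventually.of_forall fun x => (integrable_kernel 1 x).aestronglyMeasurable) ?_
    (integrable_cube_indicator _ _) ?_
  · have : ∀ᶠ x in 𝓝 t, |x| < |t| + 1 :=
      continuous_abs.continuousAt.eventually_lt_const (by linarith)
    filter_upwards [this] with x hx
    refine ae_of_all _ fun p => ?_
    rw [Real.norm_of_nonneg (kernel_nonneg _ _ _)]
    exact kernel_le_indicator p hx.le
  · have h1 : ∀ᵐ p : Fin n → ℝ, tailEval p t ≠ 1 := by
      rw [ae_iff]; simpa using volume_tailEval_eq (n := n) t one_ne_zero
    have h2 : ∀ᵐ p : Fin n → ℝ, tailEval p t ≠ -1 := by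
      rw [ae_iff]; simpa using volume_tailEval_eq (n := n) t (c := -1) (by norm_num)
    filter_upwards [h1, h2] with p hp1 hp2
    refine continuousAt_kernel fun h => ?_
    rcases (abs_eq zero_le_one).1 h with h | h
    exacts [hp1 h, hp2 h]

theorem density_pos (hn : 1 ≤ n) (t : ℝ) : 0 < density n t := by
  have hE : Continuous fun p : Fin n → ℝ => |tailEval p t| :=
    (continuous_tailEval.comp (continuous_id.prodMk continuous_const)).abs
  have hD : Continuous fun p : Fin n → ℝ => tailDeriv p t :=
    continuous_tailDeriv.comp (continuous_id.prodMk continuous_const)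
  let U : Set (Fin n → ℝ) := (⋂ k, {p | |p k| < 1}) ∩ {p | |tailEval p t| < 1} ∩
    {p | tailDeriv p t ≠ 0}
  have hU : IsOpen U := ((isOpen_iInter_of_finite fun k => isOpen_lt (by fun_prop)
    continuous_const).inter (isOpen_lt hE continuous_const)).inter (isOpen_ne_fun hD continuous_const)
  have hne : U.Nonempty := by
    let i : Fin n := ⟨0, hn⟩
    -- The polynomial `e * t` has `e < 1` and `e * |t| < 1` with nonzero derivative, so it is an
    -- interior point of the region where the integrand is positive.
    let e : ℝ := 1 / (|t| + 2)
    have ht := abs_nonneg t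
    have he : 0 < e := by positivity
    have he1 : e < 1 := by
      rw [div_lt_one (by linarith)]; linarith
    refine ⟨Pi.single i e, ⟨Set.mem_iInter.2 fun k => ?_, ?_⟩, ?_⟩
    · by_cases hk : k = i
      · subst hk; simpa [abs_of_pos he] using he1
      · simp [hk]
    · have : tailEval (Pi.single i e) t = e * t := by
        rw [tailEval, Finset.sum_eq_single i]
        · simp [i]
        · intro b _ hb; simp [hb]
        · simp
      simp only [Set.mem_ofPred_eq]
      rw [this, abs_mul, abs_of_pos he, div_mul_eq_mul_div, div_lt_one (by linarith)]
      linarith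
    · have : tailDeriv (Pi.single i e) t = e := by
        rw [tailDeriv, Finset.sum_eq_single i]
        · simp [i]
        · intro b _ hb; simp [hb]
        · simp
      simp only [Set.mem_ofPred_eq]
      rw [this]; exact he.ne'
  rw [density, integral_pos_iff_support_of_nonneg (fun p => kernel_nonneg _ _ _)
    (integrable_kernel 1 t)]
  refine (hU.measure_pos volume hne).trans_le (measure_mono fun p hp => ?_)
  obtain ⟨⟨h1, h2⟩, h3⟩ := hp
  rw [Function.mem_support, kernel, if_pos ⟨fun k => (Set.mem_iInter.1 h1 k).le, le_of_lt h2⟩]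
  exact abs_ne_zero.2 h3

/-! ### Symmetries and integrability of the density -/

theorem density_neg (t : ℝ) : density n (-t) = density n t := by
  let e : (Fin n → ℝ) ≃ₗ[ℝ] (Fin n → ℝ) :=
    LinearEquiv.piCongrRight fun k => LinearEquiv.smulOfNeZero ℝ ℝ ((-1) ^ ((k : ℕ) + 1))
      (pow_ne_zero _ (by norm_num))
  have he : ∀ p k, e p k = (-1) ^ ((k : ℕ) + 1) * p k := fun p k => rfl
  have hmp : MeasurePreserving (fun p : Fin n → ℝ => fun k : Fin n => (-1 : ℝ) ^ ((k : ℕ) + 1) * p k) := by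
    refine volume_preserving_pi fun k => ?_
    rcases neg_one_pow_eq_or ℝ ((k : ℕ) + 1) with h | h
    · rw [h, show HMul.hMul (1 : ℝ) = id from funext one_mul]
      exact MeasurePreserving.id _
    · rw [h, show HMul.hMul (-1 : ℝ) = Neg.neg from funext neg_one_mul]
      exact Measure.measurePreserving_neg _
  have hemb : MeasurableEmbedding (fun p : Fin n → ℝ => fun k : Fin n => (-1 : ℝ) ^ ((k : ℕ) + 1) * p k) :=
    e.toContinuousLinearEquiv.toHomeomorph.measurableEmbedding
  rw [density, density, ← hmp.integral_comp hemb]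
  congr 1 with p
  have sign : ∀ k : Fin n, (-1 : ℝ) ^ ((k : ℕ) + 1) * (-1) ^ ((k : ℕ) + 1) = 1 := fun k => by
    rw [← mul_pow]; norm_num
  have h1 : tailEval (fun k : Fin n => (-1 : ℝ) ^ ((k : ℕ) + 1) * p k) (-t) = tailEval p t := by
    refine Finset.sum_congr rfl fun k _ => ?_
    rw [neg_pow t]
    linear_combination p k * t ^ ((k : ℕ) + 1) * sign k
  have h2 : tailDeriv (fun k : Fin n => (-1 : ℝ) ^ ((k : ℕ) + 1) * p k) (-t) = - tailDeriv p t := by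
    rw [tailDeriv, tailDeriv, ← Finset.sum_neg_distrib]
    refine Finset.sum_congr rfl fun k _ => ?_
    rw [neg_pow t]
    have := sign k
    rw [pow_succ (-1 : ℝ)] at this ⊢
    linear_combination -((k : ℝ) + 1) * p k * t ^ (k : ℕ) * this
  have h3 : ∀ k : Fin n, |(-1) ^ ((k : ℕ) + 1) * p k| = |p k| := fun k => by
    rw [abs_mul, abs_pow]; simp
  unfold kernel
  rw [h1, h2, abs_neg]
  simp only [h3]


theorem integral_snoc {m : ℕ} (F : (Fin (m + 1) → ℝ) → ℝ) (hF : Integrable F) :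
    ∫ p, F p = ∫ q : Fin m → ℝ, ∫ u : ℝ, F (Fin.snoc (α := fun _ => ℝ) q u) := by
  let e := (MeasurableEquiv.piFinSuccAbove (fun _ : Fin (m + 1) => ℝ) (Fin.last m)).symm
  have he : MeasurePreserving e :=
    (volume_preserving_piFinSuccAbove (fun _ : Fin (m + 1) => ℝ) (Fin.last m)).symm _
  have hs : ∀ (u : ℝ) (q : Fin m → ℝ), e (u, q) = Fin.snoc (α := fun _ => ℝ) q u := fun u q => by
    simp [e, Fin.snocEquiv]
  have hI : Integrable (fun x => F (e x)) := (he.integrable_comp_emb e.measurableEmbedding).2 hF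
  rw [← he.integral_comp', Measure.volume_eq_prod, integral_prod_symm _ hI]
  simp only [hs]

theorem tailEval_snoc {m : ℕ} (q : Fin m → ℝ) (u t : ℝ) :
    tailEval (Fin.snoc (α := fun _ => ℝ) q u) t = tailEval q t + u * t ^ (m + 1) := by
  simp [tailEval, Fin.sum_univ_castSucc]

theorem tailDeriv_snoc {m : ℕ} (q : Fin m → ℝ) (u t : ℝ) :
    tailDeriv (Fin.snoc (α := fun _ => ℝ) q u) t = tailDeriv q t + (m + 1) * u * t ^ m := by
  simp [tailDeriv, Fin.sum_univ_castSucc]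

theorem tailEval_rev {m : ℕ} (q : Fin m → ℝ) {t : ℝ} (ht : t ≠ 0) :
    t ^ (m + 1) * tailEval (fun i => q (Fin.rev i)) (1 / t) = tailEval q t := by
  rw [tailEval, tailEval, Finset.mul_sum, ← Equiv.sum_comp Fin.revPerm]
  refine Finset.sum_congr rfl fun k _ => ?_
  have hk : (m + 1 : ℕ) = ((k.rev : ℕ) + 1) + (k + 1) := by
    rw [Fin.val_rev]; omega
  rw [Fin.revPerm_apply, Fin.rev_rev, hk, pow_add, one_div, inv_pow]
  field_simp

theorem tailDeriv_rev {m : ℕ} (q : Fin m → ℝ) {t : ℝ} (ht : t ≠ 0) :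
    t ^ m * tailDeriv (fun i => q (Fin.rev i)) (1 / t) =
      (m + 1) * tailEval q t - t * tailDeriv q t := by
  rw [tailEval, tailDeriv, tailDeriv, Finset.mul_sum, Finset.mul_sum, Finset.mul_sum,
    ← Finset.sum_sub_distrib, ← Equiv.sum_comp Fin.revPerm]
  refine Finset.sum_congr rfl fun k _ => ?_
  have hk : (m : ℕ) = (k.rev : ℕ) + (k + 1) := by
    rw [Fin.val_rev]; omega
  have hk' : ((k.rev : ℕ) : ℝ) = m - k - 1 := by
    have : (m : ℝ) = (k.rev : ℕ) + (k + 1) := by exact_mod_cast hk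
    linarith
  have hp : t ^ m * (1 / t) ^ (k.rev : ℕ) = t ^ ((k : ℕ) + 1) := by
    rw [show t ^ m = t ^ ((k.rev : ℕ) + (k + 1)) from congrArg _ hk, pow_add, one_div, inv_pow]
    field_simp
  rw [Fin.revPerm_apply, Fin.rev_rev, hk']
  linear_combination ((m : ℝ) - k) * q k * hp

/-- If `P` has nonconstant coefficients `q, u` and vanishes at `t`, its constant coefficient is
minus the value of the tail. The reversed polynomial vanishes at `1 / t`, has constant coefficient
`u` and has that value as leading coefficient. Both have the same set of coefficients, so the
constraints agree, and differentiating `x ^ (m + 1) * P(1 / x)` at a root relates the derivatives.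
-/
theorem kernel_snoc_rev {m : ℕ} (q : Fin m → ℝ) (u : ℝ) {t : ℝ} (ht : t ≠ 0) :
    |t| ^ m * kernel 1 (Fin.snoc (α := fun _ => ℝ) (fun i => q (Fin.rev i))
      (-(t ^ (m + 1) * u) - tailEval q t)) (1 / t) =
      |t| * kernel 1 (Fin.snoc (α := fun _ => ℝ) q u) t := by
  have h1 : tailEval (Fin.snoc (α := fun _ => ℝ) (fun i => q (Fin.rev i))
      (-(t ^ (m + 1) * u) - tailEval q t)) (1 / t) = -u := by
    rw [tailEval_snoc, ← tailEval_rev q ht, one_div_pow]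
    field_simp
    ring
  have h2 : t ^ m * tailDeriv (Fin.snoc (α := fun _ => ℝ) (fun i => q (Fin.rev i))
      (-(t ^ (m + 1) * u) - tailEval q t)) (1 / t) =
      -(t * tailDeriv (Fin.snoc (α := fun _ => ℝ) q u) t) := by
    have hp : t ^ m * (1 / t) ^ m = 1 := by rw [← mul_pow, mul_one_div_cancel ht, one_pow]
    rw [tailDeriv_snoc, tailDeriv_snoc, mul_add, tailDeriv_rev q ht]
    linear_combination (m + 1) * (-(t ^ (m + 1) * u) - tailEval q t) * hp
  have h3 : |t| ^ m * |tailDeriv (Fin.snoc (α := fun _ => ℝ) (fun i => q (Fin.rev i))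
      (-(t ^ (m + 1) * u) - tailEval q t)) (1 / t)| =
      |t| * |tailDeriv (Fin.snoc (α := fun _ => ℝ) q u) t| := by
    rw [← abs_pow, ← abs_mul, h2, abs_neg, abs_mul]
  have h4 : |-(t ^ (m + 1) * u) - tailEval q t| =
      |tailEval (Fin.snoc (α := fun _ => ℝ) q u) t| := by
    rw [tailEval_snoc, ← abs_neg]; ring_nf
  have h5 : (∀ i : Fin m, |q i.rev| ≤ 1) ↔ ∀ i, |q i| ≤ 1 :=
    ⟨fun h i => by simpa using h i.rev, fun h i => h _⟩
  unfold kernel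
  rw [mul_ite, mul_ite, mul_zero, mul_zero, h3, h1]
  refine if_congr ?_ rfl rfl
  simp only [Fin.forall_fin_succ', Fin.snoc_castSucc, Fin.snoc_last, h4, h5, abs_neg]
  tauto

/-- For fixed middle coefficients, the substitution exchanging leading and constant coefficient is
affine with Jacobian `|t| ^ (m + 1)`. Together with the factor `|t| / |t| ^ m` from
`kernel_snoc_rev` this gives `t ^ 2`. -/
theorem density_inv (hn : 1 ≤ n) {t : ℝ} (ht : t ≠ 0) : t ^ 2 * density n t = density n (1 / t) := by
  obtain ⟨m, rfl⟩ : ∃ m, n = m + 1 := ⟨n - 1, by omega⟩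
  rw [density, density, integral_snoc _ (integrable_kernel _ _),
    integral_snoc _ (integrable_kernel _ _)]
  have hrev : ∀ F : (Fin m → ℝ) → ℝ, ∫ q, F q = ∫ q : Fin m → ℝ, F fun i => q (Fin.rev i) := by
    intro F
    have := (volume_measurePreserving_piCongrLeft (fun _ : Fin m => ℝ) Fin.revPerm).integral_comp' F
    rw [← this]
    congr 1 with q
    congr 1 with i
    have := MeasurableEquiv.piCongrLeft_apply_apply (β := fun _ : Fin m => ℝ) Fin.revPerm q i.rev
    simpa using this
  rw [hrev (fun q => ∫ u : ℝ, kernel 1 (Fin.snoc (α := fun _ => ℝ) q u) (1 / t)),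
    ← integral_const_mul]
  congr 1 with q
  have hta : 0 < |t| := abs_pos.2 ht
  have h1 := integral_sub_right_eq_self (μ := (volume : Measure ℝ)) (fun u : ℝ => kernel 1
    (Fin.snoc (α := fun _ => ℝ) (fun i => q (Fin.rev i)) u) (1 / t)) (tailEval q t)
  have h2 := Measure.integral_comp_mul_left (fun u : ℝ => kernel 1
    (Fin.snoc (α := fun _ => ℝ) (fun i => q (Fin.rev i)) (u - tailEval q t)) (1 / t))
    (-t ^ (m + 1))
  rw [h1] at h2
  have h3 : ∀ u : ℝ, kernel 1 (Fin.snoc (α := fun _ => ℝ) (fun i => q (Fin.rev i))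
      (-t ^ (m + 1) * u - tailEval q t)) (1 / t) =
      |t| / |t| ^ m * kernel 1 (Fin.snoc (α := fun _ => ℝ) q u) t := fun u => by
    have := kernel_snoc_rev q u ht
    rw [neg_mul, div_mul_eq_mul_div, ← this]
    field_simp
  simp only [h3, integral_const_mul, smul_eq_mul] at h2
  rw [abs_inv, abs_neg, abs_pow] at h2
  rw [← sq_abs]
  field_simp at h2
  refine mul_left_cancel₀ (pow_pos hta m).ne' ?_
  rw [← h2]
  ring

/-- A bound `C` on `[-1, 1]` becomes `C / x ^ 2` outside by inversion; both are dominated by `2 * C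
/ (1 + x ^ 2)`. -/
theorem integrable_density (hn : 1 ≤ n) : Integrable (density n) := by
  obtain ⟨C, hC⟩ := (isCompact_Icc (a := (-1 : ℝ)) (b := 1)).exists_bound_of_continuousOn
    (continuous_density n).continuousOn
  have hC' : ∀ x : ℝ, |x| ≤ 1 → density n x ≤ C := fun x hx =>
    (le_abs_self _).trans (hC x (abs_le.1 hx))
  have hC0 : 0 ≤ C := (density_nonneg _).trans (hC' 0 (by simp))
  refine ((integrable_inv_one_add_sq).const_mul (2 * C)).mono'
    (continuous_density n).aestronglyMeasurable (ae_of_all _ fun x => ?_)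
  rw [Real.norm_of_nonneg (density_nonneg _), ← div_eq_mul_inv, le_div_iff₀ (by positivity)]
  rcases le_total |x| 1 with h | h
  · have := hC' x h
    have hx : x ^ 2 ≤ 1 := by rw [← sq_abs]; exact pow_le_one₀ (abs_nonneg x) h
    nlinarith [density_nonneg (n := n) x]
  · have hx0 : x ≠ 0 := by rintro rfl; simp at h; linarith
    have h1 := density_inv hn hx0
    have h2 := hC' (1 / x) (by
      rw [abs_div, abs_one]; exact div_le_one_of_le₀ h (abs_nonneg x))
    have hx : 1 ≤ x ^ 2 := by rw [← sq_abs]; exact one_le_pow₀ h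
    nlinarith [density_nonneg (n := n) x]

end density

open Polynomial

/-! ### Polynomials with given coefficients and their real roots -/

/-- The polynomial with the coefficients `v`. -/
def ofCoeffs {R : Type*} [Semiring R] {m : ℕ} (v : Fin m → R) : R[X] :=
  ∑ i : Fin m, monomial (i : ℕ) (v i)

section ofCoeffs

variable {R S : Type*} [Semiring R] [Semiring S] {m : ℕ}

theorem coeff_ofCoeffs (v : Fin m → R) (i : Fin m) : (ofCoeffs v).coeff i = v i := by
  simp [ofCoeffs, coeff_monomial, Fin.val_inj]

theorem coeff_ofCoeffs_of_le (v : Fin m → R) {i : ℕ} (hi : m ≤ i) : (ofCoeffs v).coeff i = 0 := by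
  rw [ofCoeffs, finsetSum_coeff]
  refine Finset.sum_eq_zero fun k _ => ?_
  rw [coeff_monomial, if_neg]
  omega

theorem natDegree_ofCoeffs_le (v : Fin (m + 1) → R) : (ofCoeffs v).natDegree ≤ m :=
  natDegree_le_iff_coeff_eq_zero.2 fun _ hi => coeff_ofCoeffs_of_le v hi

theorem ofCoeffs_coeff {p : R[X]} (hp : p.natDegree ≤ m) :
    ofCoeffs (fun i : Fin (m + 1) => p.coeff i) = p := by
  ext i
  by_cases hi : i < m + 1
  · exact coeff_ofCoeffs _ (⟨i, hi⟩ : Fin (m + 1))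
  · rw [coeff_ofCoeffs_of_le _ (not_lt.1 hi), coeff_eq_zero_of_natDegree_lt (by omega)]

theorem ofCoeffs_injective : Function.Injective (ofCoeffs : (Fin m → R) → R[X]) := fun v w h => by
  ext i; rw [← coeff_ofCoeffs v, h, coeff_ofCoeffs]

theorem ofCoeffs_zero : ofCoeffs (0 : Fin m → R) = 0 := by simp [ofCoeffs]

theorem map_ofCoeffs (f : R →+* S) (v : Fin m → R) :
    (ofCoeffs v).map f = ofCoeffs fun i => f (v i) := by
  simp [ofCoeffs, Polynomial.map_sum]

theorem ofCoeffs_smul (c : R) (v : Fin m → R) : ofCoeffs (c • v) = C c * ofCoeffs v := by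
  simp [ofCoeffs, Finset.mul_sum, C_mul_monomial]

theorem eval_ofCoeffs {R : Type*} [CommSemiring R] (v : Fin m → R) (t : R) :
    (ofCoeffs v).eval t = ∑ i : Fin m, v i * t ^ (i : ℕ) := by
  simp [ofCoeffs, eval_finsetSum]

theorem ofCoeffs_update (v : Fin m → R) (j : Fin m) (x : R) :
    ofCoeffs (Function.update v j x) =
      ofCoeffs (Function.update v j 0) + monomial (j : ℕ) x := by
  simp only [ofCoeffs]
  rw [← Finset.add_sum_erase _ _ (Finset.mem_univ j),
    ← Finset.add_sum_erase Finset.univ (fun i : Fin m => monomial (i : ℕ)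
      (Function.update v j (0 : R) i)) (Finset.mem_univ j)]
  simp only [Function.update_self, map_zero, zero_add]
  rw [add_comm]
  congr 1
  refine Finset.sum_congr rfl fun i hi => ?_
  rw [Function.update_of_ne (Finset.ne_of_mem_erase hi),
    Function.update_of_ne (Finset.ne_of_mem_erase hi)]

end ofCoeffs

open Classical in
/-- The number of nonzero roots in `I` of the polynomial with coefficients `v`
(`0` for the zero polynomial). -/
def rootCount {m : ℕ} (I : Set ℝ) (v : Fin m → ℝ) : ℕ :=
  ((ofCoeffs v).roots.toFinset.filter fun t => t ∈ I ∧ t ≠ 0).card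

theorem rootCount_le {n : ℕ} (I : Set ℝ) (v : Fin (n + 1) → ℝ) : rootCount I v ≤ n := by
  classical
  exact (Finset.card_filter_le _ _).trans ((Multiset.toFinset_card_le _).trans
    ((card_roots' _).trans (natDegree_ofCoeffs_le v)))

theorem rootCount_zero {m : ℕ} (I : Set ℝ) : rootCount I (0 : Fin m → ℝ) = 0 := by
  simp [rootCount, ofCoeffs_zero]

theorem rootCount_smul {m : ℕ} (I : Set ℝ) {c : ℝ} (hc : c ≠ 0) (v : Fin m → ℝ) :
    rootCount I (c • v) = rootCount I v := by
  rw [rootCount, rootCount, ofCoeffs_smul, roots_C_mul _ hc]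

/-! ### Injective branches along a coordinate line -/

/-- A monotone labelling that is constant exactly on the gaps between the elements of `Z`. -/
def level (Z : Finset ℝ) (t : ℝ) : ℕ := (Z.filter (· < t)).card + (Z.filter (· ≤ t)).card

theorem level_mono (Z : Finset ℝ) : Monotone (level Z) := fun a b hab => by
  refine add_le_add (Finset.card_le_card ?_) (Finset.card_le_card ?_)
  · exact Finset.monotone_filter_right _ fun z _ hz => lt_of_lt_of_le hz hab
  · exact Finset.monotone_filter_right _ fun z _ hz => le_trans hz hab

theorem level_le (Z : Finset ℝ) (t : ℝ) : level Z t ≤ 2 * Z.card := by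
  have h1 := Finset.card_filter_le Z (· < t)
  have h2 := Finset.card_filter_le Z (· ≤ t)
  unfold level; omega

/-- Two points with the same level therefore have no element of `Z` between them, endpoints
included. -/
theorem level_lt {Z : Finset ℝ} {a b z : ℝ} (hz : z ∈ Z) (hab : a < b) (haz : a ≤ z)
    (hzb : z ≤ b) : level Z a < level Z b := by
  rcases haz.eq_or_lt with rfl | haz
  · refine add_lt_add_of_lt_of_le (Finset.card_lt_card ?_) (Finset.card_le_card ?_)
    · refine Finset.ssubset_iff_subset_ne.2
        ⟨Finset.monotone_filter_right _ fun y _ hy => lt_trans hy hab, fun h => ?_⟩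
      have : a ∈ Z.filter (· < b) := Finset.mem_filter.2 ⟨hz, hab⟩
      rw [← h] at this
      exact lt_irrefl _ (Finset.mem_filter.1 this).2
    · exact Finset.monotone_filter_right _ fun y _ hy => le_trans hy hab.le
  · refine add_lt_add_of_le_of_lt (Finset.card_le_card ?_) (Finset.card_lt_card ?_)
    · exact Finset.monotone_filter_right _ fun y _ hy => lt_trans hy hab
    · refine Finset.ssubset_iff_subset_ne.2
        ⟨Finset.monotone_filter_right _ fun y _ hy => le_trans hy hab.le, fun h => ?_⟩
      have : z ∈ Z.filter (· ≤ b) := Finset.mem_filter.2 ⟨hz, hzb⟩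
      rw [← h] at this
      exact haz.not_ge (Finset.mem_filter.1 this).2

/-- The zeros of this polynomial are, up to `0`, the critical points of `h / t ^ j`. -/
def critical (h : ℝ[X]) (j : ℕ) : ℝ[X] := X * derivative h - C (j : ℝ) * h

/-- The factor vanishes only for `i = j`, so `critical h j = 0` exactly when `h` is a multiple of `X
^ j`. -/
theorem coeff_critical (h : ℝ[X]) (j i : ℕ) :
    (critical h j).coeff i = ((i : ℝ) - j) * h.coeff i := by
  rw [critical, coeff_sub, coeff_C_mul]
  cases i with
  | zero => simp
  | succ i => rw [coeff_X_mul, coeff_derivative]; push_cast; ring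

theorem natDegree_critical_le {h : ℝ[X]} {n : ℕ} (hh : h.natDegree ≤ n) (j : ℕ) :
    (critical h j).natDegree ≤ n := by
  refine natDegree_le_iff_coeff_eq_zero.2 fun i hi => ?_
  rw [coeff_critical, coeff_eq_zero_of_natDegree_lt (by omega), mul_zero]

open Classical in
/-- The breaking points: `0` and the critical points of `h / t ^ j`. -/
def breakPoints (h : ℝ[X]) (j : ℕ) : Finset ℝ := insert 0 (critical h j).roots.toFinset

theorem card_breakPoints_le {h : ℝ[X]} {n : ℕ} (hh : h.natDegree ≤ n) (j : ℕ) :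
    (breakPoints h j).card ≤ n + 1 := by
  classical
  exact (Finset.card_insert_le _ _).trans (Nat.succ_le_succ ((Multiset.toFinset_card_le _).trans
    ((card_roots' _).trans (natDegree_critical_le hh j))))

/-- The value of the coefficient `x` for which `h + x * X ^ j` vanishes at `t ≠ 0`. -/
def solution (h : ℝ[X]) (j : ℕ) (t : ℝ) : ℝ := -(h.eval t) / t ^ j

/-- The parts of `I \ {0}` on which `solution h j` is injective. -/
def branch (h : ℝ[X]) (j : ℕ) (I : Set ℝ) (i : ℕ) : Set ℝ :=
  {t | t ∈ I ∧ t ≠ 0 ∧ level (breakPoints h j) t = i}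

theorem hasDerivAt_solution (h : ℝ[X]) (j : ℕ) {t : ℝ} (ht : t ≠ 0) :
    HasDerivAt (solution h j) (-(critical h j).eval t / t ^ (j + 1)) t := by
  have h1 := ((h.hasDerivAt t).neg).div (hasDerivAt_pow j t) (pow_ne_zero _ ht)
  convert! h1 using 1
  rw [critical]
  simp only [eval_sub, eval_mul, eval_X, eval_C, Pi.neg_apply]
  cases j with
  | zero => simp; field_simp
  | succ j => field_simp; simp; ring

theorem eval_add_monomial_eq_zero_iff (h : ℝ[X]) (j : ℕ) {t : ℝ} (ht : t ≠ 0) (x : ℝ) :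
    (h + monomial j x).eval t = 0 ↔ solution h j t = x := by
  have := pow_ne_zero j ht
  rw [eval_add, eval_monomial, solution, div_eq_iff this]
  constructor <;> intro h <;> linarith

section branch

variable {h : ℝ[X]} {j : ℕ} {I : Set ℝ}

theorem not_mem_breakPoints_of_mem_branch {i : ℕ} {a b z : ℝ} (ha : a ∈ branch h j I i)
    (hb : b ∈ branch h j I i) (hab : a < b) (haz : a ≤ z) (hzb : z ≤ b) :
    z ∉ breakPoints h j := fun hz => by
  have := level_lt hz hab haz hzb
  rw [ha.2.2, hb.2.2] at this
  exact lt_irrefl _ this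

theorem zero_mem_breakPoints : (0 : ℝ) ∈ breakPoints h j := by
  classical
  exact Finset.mem_insert_self _ _

theorem ordConnected_branch (hI : I.OrdConnected) (i : ℕ) : (branch h j I i).OrdConnected := by
  refine ⟨fun a ha b hb c hc => ⟨hI.out ha.1 hb.1 hc, ?_, ?_⟩⟩
  · rintro rfl
    rcases (hc.1.trans hc.2).eq_or_lt with h | h
    · subst h
      exact ha.2.1 (le_antisymm hc.1 hc.2)
    · exact not_mem_breakPoints_of_mem_branch ha hb h hc.1 hc.2 zero_mem_breakPoints
  · have h1 := level_mono (breakPoints h j) hc.1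
    have h2 := level_mono (breakPoints h j) hc.2
    rw [ha.2.2] at h1
    rw [hb.2.2] at h2
    exact le_antisymm h2 h1

/-- By Rolle's theorem, two equal values would enclose a critical point, which is a break point; a
branch cannot straddle one. -/
theorem injOn_solution (hD : critical h j ≠ 0) (i : ℕ) :
    Set.InjOn (solution h j) (branch h j I i) := by
  classical
  have key : ∀ a ∈ branch h j I i, ∀ b ∈ branch h j I i, a < b →
      solution h j a ≠ solution h j b := by
    intro a ha b hb hab heq
    have hne : ∀ t ∈ Set.Icc a b, t ≠ 0 := fun t ht h0 =>
      not_mem_breakPoints_of_mem_branch ha hb hab ht.1 ht.2 (h0 ▸ zero_mem_breakPoints)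
    obtain ⟨c, hc, hc0⟩ := exists_hasDerivAt_eq_zero hab
      (fun t ht => (hasDerivAt_solution h j (hne t ht)).continuousAt.continuousWithinAt) heq
      (fun t ht => hasDerivAt_solution h j (hne t (Set.Ioo_subset_Icc_self ht)))
    refine not_mem_breakPoints_of_mem_branch ha hb hab hc.1.le hc.2.le (Finset.mem_insert_of_mem ?_)
    rw [Multiset.mem_toFinset, mem_roots hD, IsRoot.def]
    have := pow_ne_zero (j + 1) (hne c (Set.Ioo_subset_Icc_self hc))
    simpa [div_eq_zero_iff, this] using hc0
  intro a ha b hb heq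
  by_contra hne
  rcases lt_or_gt_of_ne hne with h1 | h1
  · exact key a ha b hb h1 heq
  · exact key b hb a ha h1 heq.symm

theorem ordConnected_image_branch (hI : I.OrdConnected) (i : ℕ) :
    (solution h j '' branch h j I i).OrdConnected := by
  refine ((ordConnected_branch hI i).isPreconnected.image _ fun t ht => ?_).ordConnected
  exact (hasDerivAt_solution h j ht.2.1).continuousAt.continuousWithinAt

/-- A point `t ≠ 0` is a root exactly when `solution h j t = x`, and by injectivity each branch
contributes one root if `x` is in its image and none otherwise. -/
theorem rootCount_eq_sum {m : ℕ} (v : Fin m → ℝ) (j : Fin m) (x : ℝ)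
    (hD : critical (ofCoeffs (Function.update v j 0)) j ≠ 0) :
    (rootCount I (Function.update v j x) : ℝ) =
      ∑ i ∈ Finset.range (2 * (breakPoints (ofCoeffs (Function.update v j 0)) j).card + 1),
        (solution (ofCoeffs (Function.update v j 0)) j ''
          branch (ofCoeffs (Function.update v j 0)) j I i).indicator (fun _ => (1 : ℝ)) x := by
  classical
  set h := ofCoeffs (Function.update v j 0) with hh
  have hP : h + monomial (j : ℕ) x ≠ 0 := fun h0 => hD <| by
    ext i
    have := congrArg (fun p => p.coeff i) h0
    simp only [coeff_add, coeff_monomial, coeff_zero] at this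
    rw [coeff_critical, coeff_zero]
    split_ifs at this with hij
    · rw [hij, sub_self, zero_mul]
    · rw [add_zero] at this
      rw [this, mul_zero]
  rw [rootCount, ofCoeffs_update, ← hh]
  set F := (h + monomial (j : ℕ) x).roots.toFinset.filter fun t => t ∈ I ∧ t ≠ 0 with hF
  have hmem : ∀ t, t ∈ F ↔ (t ∈ I ∧ t ≠ 0) ∧ solution h j t = x := fun t => by
    rw [hF, Finset.mem_filter, Multiset.mem_toFinset, mem_roots hP, IsRoot.def]
    constructor
    · rintro ⟨h1, h2⟩
      exact ⟨h2, (eval_add_monomial_eq_zero_iff h j h2.2 x).1 h1⟩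
    · rintro ⟨h2, h1⟩
      exact ⟨(eval_add_monomial_eq_zero_iff h j h2.2 x).2 h1, h2⟩
  rw [Finset.card_eq_sum_card_fiberwise (f := level (breakPoints h j))
    (t := Finset.range (2 * (breakPoints h j).card + 1))
    (fun t _ => by
      rw [Finset.mem_coe, Finset.mem_range, Nat.lt_succ_iff]; exact level_le _ _)]
  push_cast
  refine Finset.sum_congr rfl fun i _ => ?_
  rw [Set.indicator_apply]
  split_ifs with hx
  · obtain ⟨t, ht, rfl⟩ := hx
    have : F.filter (fun s => level (breakPoints h j) s = i) = {t} := by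
      ext s
      rw [Finset.mem_filter, hmem, Finset.mem_singleton]
      constructor
      · rintro ⟨⟨⟨h1, h2⟩, h3⟩, h4⟩
        exact injOn_solution hD i ⟨h1, h2, h4⟩ ht h3
      · rintro rfl
        exact ⟨⟨⟨ht.1, ht.2.1⟩, rfl⟩, ht.2.2⟩
    rw [this]; simp
  · rw [Nat.cast_eq_zero, Finset.card_eq_zero, Finset.filter_eq_empty_iff]
    intro t ht hi
    obtain ⟨⟨h1, h2⟩, h3⟩ := (hmem t).1 ht
    exact hx ⟨t, ⟨h1, h2, hi⟩, h3⟩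

/-- The degenerate case: the polynomial is the monomial `x * X ^ j`. Its only possible root is `0`,
which `rootCount` leaves out. -/
theorem rootCount_eq_zero_of_critical {m : ℕ} (v : Fin m → ℝ) (j : Fin m) (x : ℝ)
    (hD : critical (ofCoeffs (Function.update v j 0)) j = 0) :
    rootCount I (Function.update v j x) = 0 := by
  classical
  have h0 : ofCoeffs (Function.update v j 0) = 0 := by
    ext i
    rw [coeff_zero]
    by_cases hij : i = j
    · rw [hij, coeff_ofCoeffs, Function.update_self]
    · have := congrArg (fun p => p.coeff i) hD
      simp only [coeff_critical, coeff_zero] at this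
      refine (mul_eq_zero.1 this).resolve_left (sub_ne_zero.2 ?_)
      exact_mod_cast hij
  rw [rootCount, ofCoeffs_update, h0, zero_add, Finset.card_eq_zero, Finset.filter_eq_empty_iff]
  rintro t ht ⟨-, ht0⟩
  rw [Multiset.mem_toFinset] at ht
  obtain ⟨h1, h2⟩ := mem_roots'.1 ht
  rw [IsRoot.def, eval_monomial] at h2
  refine h1 ?_
  rw [(mul_eq_zero.1 h2).resolve_right (pow_ne_zero _ ht0), map_zero]

end branch

/-- Along every coordinate line the number of roots is a sum of boundedly many indicator functions
of intervals. -/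
theorem exists_rootCount_eq_sum_indicator {n : ℕ} {I : Set ℝ} (hI : I.OrdConnected)
    (v : Fin (n + 1) → ℝ) (j : Fin (n + 1)) :
    ∃ (s : Finset ℕ) (A : ℕ → Set ℝ), s.card ≤ 2 * n + 3 ∧ (∀ i, (A i).OrdConnected) ∧
      ∀ x, (rootCount I (Function.update v j x) : ℝ) =
        ∑ i ∈ s, (A i).indicator (fun _ => (1 : ℝ)) x := by
  by_cases hD : critical (ofCoeffs (Function.update v j 0)) j = 0
  · refine ⟨∅, fun _ => ∅, by simp, fun _ => Set.ordConnected_empty, fun x => ?_⟩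
    rw [rootCount_eq_zero_of_critical v j x hD]; simp
  · refine ⟨_, _, ?_, fun i => ordConnected_image_branch hI i,
      fun x => rootCount_eq_sum v j x hD⟩
    -- There are at most `n + 1` break points, so the levels run from `0` to at most `2 * (n + 1)`.
    have := card_breakPoints_le (natDegree_ofCoeffs_le (Function.update v j 0)) (j : ℕ)
    rw [Finset.card_range]; omega

/-! ### The Kac–Rice formula in the constant coefficient -/

theorem eval_ofCoeffs_cons {n : ℕ} (x : ℝ) (p : Fin n → ℝ) (t : ℝ) :
    (ofCoeffs (Fin.cons x p : Fin (n + 1) → ℝ)).eval t = x + tailEval p t := by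
  simp [eval_ofCoeffs, Fin.sum_univ_succ, tailEval]

theorem hasDerivAt_tailEval {n : ℕ} (p : Fin n → ℝ) (t : ℝ) :
    HasDerivAt (fun t => tailEval p t) (tailDeriv p t) t := by
  unfold tailEval tailDeriv
  refine HasDerivAt.fun_sum fun k _ => ?_
  convert! (hasDerivAt_pow ((k : ℕ) + 1) t).const_mul (p k) using 1
  push_cast
  ring

theorem integrable_indicator_of_ordConnected {A : Set ℝ} (hA : A.OrdConnected) (Q : ℝ) :
    Integrable ((Set.Icc (-Q) Q ∩ A).indicator fun _ => (1 : ℝ)) := by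
  rw [integrable_indicator_iff (measurableSet_Icc.inter hA.measurableSet)]
  exact integrableOn_const ((measure_mono Set.inter_subset_left).trans_lt
    isCompact_Icc.measure_lt_top).ne

theorem integrable_rootCount_line {n : ℕ} {I : Set ℝ} (hI : I.OrdConnected)
    (v : Fin (n + 1) → ℝ) (j : Fin (n + 1)) (Q : ℝ) :
    Integrable fun x => (Set.Icc (-Q) Q).indicator
      (fun x => (rootCount I (Function.update v j x) : ℝ)) x := by
  obtain ⟨s, A, -, hA, h⟩ := exists_rootCount_eq_sum_indicator hI v j
  have : (fun x => (Set.Icc (-Q) Q).indicator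
      (fun x => (rootCount I (Function.update v j x) : ℝ)) x) =
      fun x => ∑ i ∈ s, (Set.Icc (-Q) Q ∩ A i).indicator (fun _ => (1 : ℝ)) x := by
    ext x
    by_cases hx : x ∈ Set.Icc (-Q) Q
    · rw [Set.indicator_of_mem hx, h]
      refine Finset.sum_congr rfl fun i _ => ?_
      exact Set.indicator_eq_indicator (by simp [hx.1, hx.2]) rfl
    · rw [Set.indicator_of_notMem hx, Finset.sum_eq_zero]
      intro i _
      exact Set.indicator_of_notMem (fun h => hx h.1) _
  rw [this]
  exact integrable_finsetSum _ fun i _ => integrable_indicator_of_ordConnected (hA i) Q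

/-- For the constant coefficient the solution function is `-tailEval p`. On each branch it is
injective with derivative `-tailDeriv p`, so the measure of its image is computed by the change of
variables formula; the branches cover `I` up to the point `0`. -/
theorem integral_rootCount_cons {n : ℕ} {I : Set ℝ} (hI : I.OrdConnected) (p : Fin n → ℝ) (Q : ℝ) :
    ∫ x, (Set.Icc (-Q) Q).indicator
      (fun x => (rootCount I (Fin.cons x p : Fin (n + 1) → ℝ) : ℝ)) x =
    ∫ t in I, |tailDeriv p t| * (Set.Icc (-Q) Q).indicator (fun _ => 1) (tailEval p t) := by
  have hu : ∀ x : ℝ, (Fin.cons x p : Fin (n + 1) → ℝ) =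
      Function.update (Fin.cons 0 p : Fin (n + 1) → ℝ) 0 x := fun x => by
    rw [Fin.update_cons_zero]
  set h := ofCoeffs (Fin.cons 0 p : Fin (n + 1) → ℝ) with hh
  have hh' : ofCoeffs (Function.update (Fin.cons 0 p : Fin (n + 1) → ℝ) 0 0) = h := by
    rw [← hu]
  have hev : ∀ t, h.eval t = tailEval p t := fun t => by
    rw [hh, eval_ofCoeffs_cons, zero_add]
  have hder : ∀ t, h.derivative.eval t = tailDeriv p t := fun t => by
    have h1 := h.hasDerivAt t
    simp only [hev] at h1
    exact h1.unique (hasDerivAt_tailEval p t)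
  set w : ℝ → ℝ := (Set.Icc (-Q) Q).indicator (fun _ => 1) with hw
  have hweven : ∀ x, w (-x) = w x := fun x => by
    refine Set.indicator_eq_indicator ?_ rfl
    simp only [Set.mem_Icc]
    constructor <;> rintro ⟨h1, h2⟩ <;> constructor <;> linarith
  have hwint : Integrable w := by
    rw [hw, integrable_indicator_iff measurableSet_Icc]
    exact integrableOn_const isCompact_Icc.measure_lt_top.ne
  -- Here `critical h 0 = X * h'`, so the degenerate case is that of a vanishing derivative, where
  -- both sides are `0`.
  by_cases hD : critical h 0 = 0
  · have hz : ∀ t, t ≠ 0 → tailDeriv p t = 0 := fun t ht => by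
      have := congrArg (fun q => q.eval t) hD
      simpa [critical, hder, ht] using this
    have h1 : (fun x => (Set.Icc (-Q) Q).indicator
        (fun x => (rootCount I (Fin.cons x p : Fin (n + 1) → ℝ) : ℝ)) x) = fun _ => 0 := by
      ext x
      rw [Set.indicator_apply_eq_zero]
      intro _
      rw [hu, rootCount_eq_zero_of_critical _ _ _ (by rw [hh']; exact hD), Nat.cast_zero]
    rw [h1, integral_zero]
    symm
    refine integral_eq_zero_of_ae ?_
    refine ae_restrict_of_ae ?_
    filter_upwards [Measure.ae_ne volume (0 : ℝ)] with t ht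
    simp [hz t ht]
  · let J := branch h 0 I
    let N := 2 * (breakPoints h 0).card + 1
    have hJ : ∀ i, (J i).OrdConnected := fun i => ordConnected_branch hI i
    have hA : ∀ i, (solution h 0 '' J i).OrdConnected := fun i => ordConnected_image_branch hI i
    have hsol : ∀ t, solution h 0 t = -tailEval p t := fun t => by simp [solution, hev]
    have hd : ∀ i, ∀ t ∈ J i, HasDerivWithinAt (solution h 0) (-tailDeriv p t) (J i) t := by
      intro i t _
      have : solution h 0 = fun t => -tailEval p t := funext hsol
      rw [this]
      exact (hasDerivAt_tailEval p t).neg.hasDerivWithinAt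
    have h1 : (fun x => (Set.Icc (-Q) Q).indicator
        (fun x => (rootCount I (Fin.cons x p : Fin (n + 1) → ℝ) : ℝ)) x) =
        fun x => ∑ i ∈ Finset.range N, (solution h 0 '' J i).indicator w x := by
      ext x
      by_cases hx : x ∈ Set.Icc (-Q) Q
      · rw [Set.indicator_of_mem hx, hu, rootCount_eq_sum _ _ _ (by rw [hh']; exact hD), hh']
        refine Finset.sum_congr rfl fun i _ => ?_
        refine Set.indicator_eq_indicator Iff.rfl ?_
        rw [hw, Set.indicator_of_mem hx]
      · rw [Set.indicator_of_notMem hx, Finset.sum_eq_zero]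
        intro i _
        rw [Set.indicator_apply_eq_zero]
        intro _
        exact Set.indicator_of_notMem hx _
    rw [h1, integral_finsetSum _ fun i _ => hwint.indicator (hA i).measurableSet]
    have h2 : ∀ i, ∫ x, (solution h 0 '' J i).indicator w x =
        ∫ t in J i, |tailDeriv p t| * w (tailEval p t) := fun i => by
      rw [integral_indicator (hA i).measurableSet, integral_image_eq_integral_abs_deriv_smul
        (hJ i).measurableSet (hd i) (injOn_solution hD i)]
      simp only [abs_neg, hsol, hweven, smul_eq_mul]
    have h3 : ∀ i, IntegrableOn (fun t => |tailDeriv p t| * w (tailEval p t)) (J i) := fun i => by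
      have := (integrableOn_image_iff_integrableOn_abs_deriv_smul (hJ i).measurableSet (hd i)
        (injOn_solution hD i) w).1 hwint.integrableOn
      simpa only [abs_neg, hsol, hweven, smul_eq_mul] using this
    have h4 : (⋃ i ∈ Finset.range N, J i) = I \ {0} := by
      ext t
      simp only [Set.mem_iUnion, Finset.mem_range, Set.mem_sdiff, Set.mem_singleton_iff]
      constructor
      · rintro ⟨i, _, h1, h2, _⟩
        exact ⟨h1, h2⟩
      · rintro ⟨h1, h2⟩
        exact ⟨_, Nat.lt_succ_iff.2 (level_le _ _), h1, h2, rfl⟩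
    have h5 : (I \ {0} : Set ℝ) =ᵐ[volume] I := sdiff_null_ae_eq_self (by simp)
    rw [Finset.sum_congr rfl fun i _ => h2 i, ← integral_biUnion_finset _
      (fun i _ => (hJ i).measurableSet) ?_ (fun i _ => h3 i), h4, setIntegral_congr_set h5]
    intro i _ k _ hik
    refine Set.disjoint_left.2 fun t hi hk => hik ?_
    exact hi.2.2.symm.trans hk.2.2

/-! ### Lattice points and integrals -/

/-- The integer vectors with entries of absolute value at most `B`. -/
def latticeBox (m B : ℕ) : Finset (Fin m → ℤ) :=
  Fintype.piFinset fun _ => Finset.Icc (-(B : ℤ)) B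

/-- An integer vector as a real vector. -/
def intVec {m : ℕ} (k : Fin m → ℤ) : Fin m → ℝ := fun i => (k i : ℝ)

theorem mem_latticeBox {m B : ℕ} {k : Fin m → ℤ} : k ∈ latticeBox m B ↔ ∀ i, |k i| ≤ B := by
  simp [latticeBox, Fintype.mem_piFinset, abs_le]

theorem card_latticeBox (m B : ℕ) : (latticeBox m B).card = (2 * B + 1) ^ m := by
  rw [latticeBox, Fintype.card_piFinset]
  simp only [Int.card_Icc, Finset.prod_const, Finset.card_univ, Fintype.card_fin]
  congr 1
  omega

theorem sum_latticeBox_succ {m B : ℕ} (j : Fin (m + 1)) (f : (Fin (m + 1) → ℤ) → ℝ) :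
    ∑ k ∈ latticeBox (m + 1) B, f k =
      ∑ r ∈ latticeBox m B, ∑ x ∈ Finset.Icc (-(B : ℤ)) B, f (j.insertNth x r) := by
  rw [Finset.sum_comm, ← Finset.sum_product' (f := fun x r => f (j.insertNth x r))]
  symm
  refine Finset.sum_equiv (Fin.insertNthEquiv (fun _ => ℤ) j) ?_ ?_
  · rintro ⟨x, r⟩
    simp [mem_latticeBox, Fin.forall_iff_succAbove j, abs_le]
  · rintro ⟨x, r⟩ _
    rfl

/-- The steps from `k` to `k + s` have disjoint interiors because `s ≤ 1`. An interval is entered by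
at most one of them and left by at most one. -/
theorem sum_abs_sub_indicator_le {A : Set ℝ} (hA : A.OrdConnected) {s : ℝ} (hs0 : 0 ≤ s)
    (hs1 : s ≤ 1) (K : Finset ℤ) :
    ∑ k ∈ K, |A.indicator (fun _ => (1 : ℝ)) (k + s) - A.indicator (fun _ => (1 : ℝ)) k| ≤ 2 := by
  classical
  have h1 : ∀ k : ℤ, |A.indicator (fun _ => (1 : ℝ)) (k + s) - A.indicator (fun _ => (1 : ℝ)) k| =
      (if (k : ℝ) ∉ A ∧ (k : ℝ) + s ∈ A then 1 else 0) +
        (if (k : ℝ) ∈ A ∧ (k : ℝ) + s ∉ A then 1 else 0) := fun k => by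
    by_cases ha : (k : ℝ) ∈ A <;> by_cases hb : (k : ℝ) + s ∈ A <;> simp [ha, hb]
  have hle : ∀ {k l : ℤ}, k < l → (k : ℝ) + s ≤ l := fun {k l} h => by
    have : (k : ℝ) + 1 ≤ l := by exact_mod_cast h
    linarith
  have h2 : (K.filter fun k : ℤ => (k : ℝ) ∉ A ∧ (k : ℝ) + s ∈ A).card ≤ 1 := by
    refine Finset.card_le_one.2 fun k hk l hl => ?_
    have key : ∀ {k l : ℤ}, (k : ℝ) + s ∈ A → (l : ℝ) ∉ A → (l : ℝ) + s ∈ A → ¬ k < l :=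
      fun h1 h2 h3 h4 => h2 (hA.out h1 h3 ⟨hle h4, by linarith⟩)
    have hk' := (Finset.mem_filter.1 hk).2
    have hl' := (Finset.mem_filter.1 hl).2
    exact le_antisymm (not_lt.1 (key hl'.2 hk'.1 hk'.2)) (not_lt.1 (key hk'.2 hl'.1 hl'.2))
  have h3 : (K.filter fun k : ℤ => (k : ℝ) ∈ A ∧ (k : ℝ) + s ∉ A).card ≤ 1 := by
    refine Finset.card_le_one.2 fun k hk l hl => ?_
    have key : ∀ {k l : ℤ}, (k : ℝ) ∈ A → (k : ℝ) + s ∉ A → (l : ℝ) ∈ A → ¬ k < l :=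
      fun h1 h2 h3 h4 => h2 (hA.out h1 h3 ⟨by linarith, hle h4⟩)
    have hk' := (Finset.mem_filter.1 hk).2
    have hl' := (Finset.mem_filter.1 hl).2
    exact le_antisymm (not_lt.1 (key hl'.1 hl'.2 hk'.1)) (not_lt.1 (key hk'.1 hk'.2 hl'.1))
  rw [Finset.sum_congr rfl fun k _ => h1 k, Finset.sum_add_distrib, Finset.sum_boole,
    Finset.sum_boole]
  have : ((K.filter fun k : ℤ => (k : ℝ) ∉ A ∧ (k : ℝ) + s ∈ A).card : ℝ) ≤ 1 := by
    exact_mod_cast h2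
  have : ((K.filter fun k : ℤ => (k : ℝ) ∈ A ∧ (k : ℝ) + s ∉ A).card : ℝ) ≤ 1 := by
    exact_mod_cast h3
  linarith

/-- The number of roots in `I`, cut off to the cube of the coefficient vectors. -/
def cubeCount {n : ℕ} (Q : ℝ) (I : Set ℝ) (v : Fin (n + 1) → ℝ) : ℝ :=
  (cube (n + 1) Q).indicator (fun v => (rootCount I v : ℝ)) v

theorem sum_abs_sub_cubeCount_line_le {n : ℕ} (Q : ℝ) {I : Set ℝ} (hI : I.OrdConnected)
    (v : Fin (n + 1) → ℝ) (j : Fin (n + 1)) {s : ℝ} (hs0 : 0 ≤ s) (hs1 : s ≤ 1) (K : Finset ℤ) :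
    ∑ k ∈ K, |cubeCount Q I (Function.update v j (k + s)) -
      cubeCount Q I (Function.update v j k)| ≤ 2 * (2 * n + 3) := by
  have hmem : ∀ x : ℝ, Function.update v j x ∈ cube (n + 1) Q ↔
      x ∈ Set.Icc (-Q) Q ∧ ∀ i, i ≠ j → |v i| ≤ Q := fun x => by
    rw [mem_cube]
    constructor
    · intro h
      refine ⟨abs_le.1 (by simpa using h j), fun i hi => by simpa [hi] using h i⟩
    · rintro ⟨h1, h2⟩ i
      by_cases hi : i = j
      · subst hi; simpa [abs_le] using h1
      · simpa [hi] using h2 i hi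
  by_cases hv : ∀ i, i ≠ j → |v i| ≤ Q
  · obtain ⟨S, A, hS, hA, h⟩ := exists_rootCount_eq_sum_indicator hI v j
    have hA' : ∀ i, (Set.Icc (-Q) Q ∩ A i).OrdConnected := fun i =>
      Set.ordConnected_Icc.inter (hA i)
    have hG : ∀ x, cubeCount Q I (Function.update v j x) =
        ∑ i ∈ S, (Set.Icc (-Q) Q ∩ A i).indicator (fun _ => (1 : ℝ)) x := fun x => by
      rw [cubeCount]
      by_cases hx : x ∈ Set.Icc (-Q) Q
      · rw [Set.indicator_of_mem ((hmem x).2 ⟨hx, hv⟩), h]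
        exact Finset.sum_congr rfl fun i _ =>
          Set.indicator_eq_indicator (by simp [hx.1, hx.2]) rfl
      · rw [Set.indicator_of_notMem (fun h => hx ((hmem x).1 h).1), Finset.sum_eq_zero]
        exact fun i _ => Set.indicator_of_notMem (fun h => hx h.1) _
    simp only [hG, ← Finset.sum_sub_distrib]
    calc _ ≤ ∑ k ∈ K, ∑ i ∈ S, |(Set.Icc (-Q) Q ∩ A i).indicator (fun _ => (1 : ℝ)) (k + s) -
          (Set.Icc (-Q) Q ∩ A i).indicator (fun _ => (1 : ℝ)) k| :=
          Finset.sum_le_sum fun k _ => Finset.abs_sum_le_sum_abs _ _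
      _ ≤ ∑ i ∈ S, (2 : ℝ) := by
          rw [Finset.sum_comm]
          exact Finset.sum_le_sum fun i _ => sum_abs_sub_indicator_le (hA' i) hs0 hs1 K
      _ ≤ 2 * (2 * n + 3) := by
          rw [Finset.sum_const, nsmul_eq_mul, mul_comm]
          have : (S.card : ℝ) ≤ 2 * n + 3 := by exact_mod_cast hS
          linarith
  · have hG : ∀ x, cubeCount Q I (Function.update v j x) = 0 := fun x =>
      Set.indicator_of_notMem (fun h => hv ((hmem x).1 h).2) _
    simp only [hG, sub_self, abs_zero, Finset.sum_const_zero]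
    positivity

/-- Shifting the lattice by a vector of the unit cube changes the sum by little. -/
theorem abs_sum_cubeCount_sub_le {n : ℕ} (Q : ℝ) {I : Set ℝ} (hI : I.OrdConnected) (B : ℕ)
    {s : Fin (n + 1) → ℝ} (hs0 : ∀ i, 0 ≤ s i) (hs1 : ∀ i, s i ≤ 1) :
    |∑ k ∈ latticeBox (n + 1) B, cubeCount Q I (intVec k) -
      ∑ k ∈ latticeBox (n + 1) B, cubeCount Q I (intVec k + s)| ≤
      (n + 1) * (2 * (2 * n + 3) * (2 * B + 1) ^ n) := by
  -- Telescoping: `c j` shifts only the first `j` coordinates, so consecutive sums differ by a shift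
  -- in one coordinate.
  let c : ℕ → Fin (n + 1) → ℝ := fun j i => if (i : ℕ) < j then s i else 0
  let T : ℕ → ℝ := fun j => ∑ k ∈ latticeBox (n + 1) B, cubeCount Q I (intVec k + c j)
  have step : ∀ j : Fin (n + 1), |T (j + 1) - T j| ≤ 2 * (2 * n + 3) * (2 * B + 1) ^ n := by
    intro j
    have h1 : ∀ (r : Fin n → ℤ) (x : ℤ), intVec (j.insertNth x r : Fin (n + 1) → ℤ) + c j =
        Function.update (intVec (j.insertNth 0 r : Fin (n + 1) → ℤ) + c j) j x := by
      intro r x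
      ext i
      by_cases hi : i = j
      · subst hi; simp [intVec, c]
      · obtain ⟨i', rfl⟩ := Fin.exists_succAbove_eq hi
        simp [intVec]
    have h2 : ∀ (r : Fin n → ℤ) (x : ℤ), intVec (j.insertNth x r : Fin (n + 1) → ℤ) + c (j + 1) =
        Function.update (intVec (j.insertNth 0 r : Fin (n + 1) → ℤ) + c j) j (x + s j) := by
      intro r x
      ext i
      by_cases hi : i = j
      · subst hi; simp [intVec, c]
      · have : (i : ℕ) < j + 1 ↔ (i : ℕ) < j := by
          have : (i : ℕ) ≠ j := fun h => hi (Fin.ext h)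
          omega
        simp only [Function.update_of_ne hi, Pi.add_apply, c, this]
        obtain ⟨i', rfl⟩ := Fin.exists_succAbove_eq hi
        simp [intVec]
    simp only [T]
    rw [sum_latticeBox_succ j, sum_latticeBox_succ j, ← Finset.sum_sub_distrib]
    simp only [← Finset.sum_sub_distrib]
    calc _ ≤ ∑ r ∈ latticeBox n B, (2 * (2 * n + 3) : ℝ) := by
          refine (Finset.abs_sum_le_sum_abs _ _).trans (Finset.sum_le_sum fun r _ => ?_)
          refine (Finset.abs_sum_le_sum_abs _ _).trans ?_
          refine (Finset.sum_congr rfl fun x _ => ?_).trans_le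
            (sum_abs_sub_cubeCount_line_le Q hI
              (intVec (j.insertNth 0 r : Fin (n + 1) → ℤ) + c j) j (hs0 j) (hs1 j) _)
          rw [h1 r x, h2 r x]
      _ = _ := by
          rw [Finset.sum_const, card_latticeBox, nsmul_eq_mul]; push_cast; ring
  have hT : ∀ j : ℕ, j ≤ n + 1 → |T j - T 0| ≤ j * (2 * (2 * n + 3) * (2 * B + 1) ^ n) := by
    intro j
    induction j with
    | zero => simp
    | succ j ih =>
      intro hj
      have h1 := ih (by omega)
      have h2 := step ⟨j, by omega⟩
      have h3 : T (j + 1) - T 0 = (T (j + 1) - T j) + (T j - T 0) := by ring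
      rw [h3]
      refine (abs_add_le _ _).trans ?_
      push_cast
      simp only at h2
      linarith
  have h0 : c 0 = 0 := by ext i; simp [c]
  have h1 : c (n + 1) = s := by ext i; simp only [c, i.isLt, if_true]
  have := hT (n + 1) le_rfl
  simp only [T, h0, h1, add_zero] at this
  rw [abs_sub_comm]
  simpa using this

/-! ### Averaging over shifts: from lattice sums to integrals -/

theorem integral_eq_sum_translates {E ι : Type*} [AddCommGroup E] [MeasurableSpace E]
    [MeasurableAdd E] {μ : Measure E} [μ.IsAddLeftInvariant] {D : Set E} (hD : MeasurableSet D)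
    (L : Finset ι) (c : ι → E)
    (hd : (L : Set ι).Pairwise fun a b => ∀ x, x - c a ∈ D → x - c b ∉ D) {f : E → ℝ}
    (hf : Integrable f μ) (hs : ∀ x, f x ≠ 0 → ∃ a ∈ L, x - c a ∈ D) :
    ∫ x, f x ∂μ = ∑ a ∈ L, ∫ s in D, f (c a + s) ∂μ := by
  have hm : ∀ a, MeasurableSet {x | x - c a ∈ D} := fun a => by
    simp only [sub_eq_add_neg]
    exact (measurable_add_const _) hD
  have h1 : ∀ a, ∫ s in D, f (c a + s) ∂μ = ∫ x in {x | x - c a ∈ D}, f x ∂μ := fun a => by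
    rw [← integral_indicator hD, ← integral_indicator (hm a),
      ← integral_add_left_eq_self ({x | x - c a ∈ D}.indicator f) (c a)]
    congr 1 with x
    classical
    simp only [Set.indicator_apply, Set.mem_ofPred_eq, add_sub_cancel_left]
  rw [Finset.sum_congr rfl fun a _ => h1 a, ← integral_biUnion_finset _ (fun a _ => hm a) ?_
    (fun a _ => hf.integrableOn)]
  · refine (setIntegral_eq_integral_of_forall_compl_eq_zero fun x hx => ?_).symm
    by_contra h
    obtain ⟨a, ha, hx'⟩ := hs x h
    exact hx (Set.mem_iUnion₂.2 ⟨a, ha, hx'⟩)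
  · intro a ha b hb hab
    exact Set.disjoint_left.2 fun x hxa hxb => hd ha hb hab x hxa hxb

theorem abs_sub_setIntegral_le {E : Type*} [MeasurableSpace E] {μ : Measure E} {D : Set E}
    (hμ : μ D = 1) {f : E → ℝ} (hf : IntegrableOn f D μ) {a C : ℝ}
    (h : ∀ s ∈ D, |a - f s| ≤ C) : |a - ∫ s in D, f s ∂μ| ≤ C := by
  have h1 : a = ∫ _ in D, a ∂μ := by simp [Measure.real, hμ]
  have h2 : IntegrableOn (fun _ => a) D μ := integrableOn_const (by simp [hμ])
  rw [h1, ← integral_sub h2 hf]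
  have := norm_setIntegral_le_of_norm_le_const (μ := μ) (s := D) (f := fun s => a - f s) (C := C)
    (by simp [hμ]) h
  simpa [Measure.real, hμ] using this

/-- The half-open unit cube. -/
def unitCube (n : ℕ) : Set (Fin n → ℝ) := Set.univ.pi fun _ => Set.Ico 0 1

theorem measurableSet_unitCube (n : ℕ) : MeasurableSet (unitCube n) :=
  MeasurableSet.univ_pi fun _ => measurableSet_Ico

theorem volume_unitCube (n : ℕ) : volume (unitCube n) = 1 := by
  simp [unitCube, volume_pi_pi]

theorem sub_intCast_mem_Ico_iff {x : ℝ} {k : ℤ} : x - k ∈ Set.Ico (0 : ℝ) 1 ↔ ⌊x⌋ = k := by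
  rw [Int.floor_eq_iff, Set.mem_Ico]
  constructor <;> rintro ⟨h1, h2⟩ <;> constructor <;> linarith

theorem floor_mem_Icc {x Q : ℝ} (hx : |x| ≤ Q) : ⌊x⌋ ∈ Finset.Icc (-(⌈Q⌉₊ : ℤ)) ⌈Q⌉₊ := by
  have h1 := abs_le.1 hx
  have h2 := Nat.le_ceil Q
  rw [Finset.mem_Icc]
  constructor
  · rw [Int.le_floor]; push_cast; linarith
  · have : (⌊x⌋ : ℝ) ≤ ((⌈Q⌉₊ : ℤ) : ℝ) := by
      push_cast; linarith [Int.floor_le x]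
    exact_mod_cast this

theorem integral_eq_sum_Ico {f : ℝ → ℝ} (hf : Integrable f) {Q : ℝ}
    (hs : ∀ x, f x ≠ 0 → |x| ≤ Q) :
    ∫ x, f x = ∑ k ∈ Finset.Icc (-(⌈Q⌉₊ : ℤ)) ⌈Q⌉₊, ∫ s in Set.Ico (0 : ℝ) 1, f (k + s) := by
  refine integral_eq_sum_translates measurableSet_Ico _ (fun k : ℤ => (k : ℝ)) ?_ hf ?_
  · intro a _ b _ hab x ha hb
    exact hab ((sub_intCast_mem_Ico_iff.1 ha).symm.trans (sub_intCast_mem_Ico_iff.1 hb))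
  · intro x hx
    exact ⟨⌊x⌋, floor_mem_Icc (hs x hx), sub_intCast_mem_Ico_iff.2 rfl⟩

theorem integral_eq_sum_unitCube {n : ℕ} {f : (Fin n → ℝ) → ℝ} (hf : Integrable f) {Q : ℝ}
    (hs : ∀ x, f x ≠ 0 → x ∈ cube n Q) :
    ∫ x, f x = ∑ k ∈ latticeBox n ⌈Q⌉₊, ∫ s in unitCube n, f (intVec k + s) := by
  refine integral_eq_sum_translates (measurableSet_unitCube n) _ intVec ?_ hf ?_
  · intro a _ b _ hab x ha hb
    refine hab (funext fun i => ?_)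
    exact (sub_intCast_mem_Ico_iff.1 (ha i trivial)).symm.trans
      (sub_intCast_mem_Ico_iff.1 (hb i trivial))
  · intro x hx
    refine ⟨fun i => ⌊x i⌋, ?_, fun i _ => sub_intCast_mem_Ico_iff.2 rfl⟩
    rw [latticeBox, Fintype.mem_piFinset]
    exact fun i => floor_mem_Icc (mem_cube.1 (hs x hx) i)

theorem cons_mem_cube {n : ℕ} {x Q : ℝ} {q : Fin n → ℝ} :
    (Fin.cons x q : Fin (n + 1) → ℝ) ∈ cube (n + 1) Q ↔ |x| ≤ Q ∧ q ∈ cube n Q := by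
  simp [mem_cube, Fin.forall_fin_succ]

theorem integrable_cubeCount_cons {n : ℕ} (Q : ℝ) {I : Set ℝ} (hI : I.OrdConnected)
    (q : Fin n → ℝ) : Integrable fun x : ℝ => cubeCount Q I (Fin.cons x q) := by
  by_cases hq : q ∈ cube n Q
  · refine (integrable_rootCount_line hI (Fin.cons 0 q) 0 Q).congr (ae_of_all _ fun x => ?_)
    simp only [Fin.update_cons_zero]
    rw [cubeCount]
    classical
    simp only [Set.indicator_apply, cons_mem_cube, hq, and_true, abs_le, Set.mem_Icc]
  · refine (integrable_zero ℝ ℝ volume).congr (ae_of_all _ fun x => ?_)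
    exact (Set.indicator_of_notMem (fun h => hq (cons_mem_cube.1 h).2) _).symm

theorem integral_cubeCount_cons {n : ℕ} (Q : ℝ) {I : Set ℝ} (hI : I.OrdConnected)
    (q : Fin n → ℝ) : ∫ x : ℝ, cubeCount Q I (Fin.cons x q) = ∫ t in I, kernel Q q t := by
  classical
  by_cases hq : q ∈ cube n Q
  · have h1 : ∀ x : ℝ, cubeCount Q I (Fin.cons x q) = (Set.Icc (-Q) Q).indicator
        (fun x => (rootCount I (Fin.cons x q : Fin (n + 1) → ℝ) : ℝ)) x := fun x => by
      rw [cubeCount]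
      simp only [Set.indicator_apply, cons_mem_cube, hq, and_true, abs_le, Set.mem_Icc]
    simp only [h1]
    rw [integral_rootCount_cons hI q Q]
    congr 1 with t
    rw [kernel, Set.indicator_apply, mul_ite, mul_one, mul_zero]
    refine if_congr ?_ rfl rfl
    rw [Set.mem_Icc, ← abs_le]
    exact ⟨fun h => ⟨mem_cube.1 hq, h⟩, fun h => h.2⟩
  · have h1 : ∀ x : ℝ, cubeCount Q I (Fin.cons x q) = 0 := fun x =>
      Set.indicator_of_notMem (fun h => hq (cons_mem_cube.1 h).2) _
    have h2 : ∀ t, kernel Q q t = 0 := fun t => if_neg fun h => hq (mem_cube.2 h.1)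
    simp [h1, h2]

theorem integrable_kernel_prod {n : ℕ} (hn : 1 ≤ n) {Q : ℝ} (hQ : 0 < Q) (I : Set ℝ) :
    Integrable (fun x : (Fin n → ℝ) × ℝ => kernel Q x.1 x.2)
      (volume.prod (volume.restrict I)) := by
  rw [integrable_prod_iff' (measurable_kernel Q).aestronglyMeasurable]
  refine ⟨ae_of_all _ fun t => integrable_kernel Q t, ?_⟩
  simp only [Real.norm_of_nonneg (kernel_nonneg _ _ _), integral_kernel hQ]
  exact ((integrable_density hn).const_mul _).restrict

theorem integral_integral_kernel {n : ℕ} (hn : 1 ≤ n) {Q : ℝ} (hQ : 0 < Q) (I : Set ℝ) :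
    ∫ q : Fin n → ℝ, ∫ t in I, kernel Q q t = Q ^ (n + 1) * ∫ t in I, density n t := by
  rw [integral_integral_swap (integrable_kernel_prod hn hQ I)]
  simp only [integral_kernel hQ, integral_const_mul]

theorem intVec_cons_add {n : ℕ} (x : ℤ) (r : Fin n → ℤ) (a : ℝ) (s : Fin n → ℝ) :
    intVec (Fin.cons x r : Fin (n + 1) → ℤ) + (Fin.cons a s : Fin (n + 1) → ℝ) =
      (Fin.cons (x + a) (intVec r + s) : Fin (n + 1) → ℝ) := by
  ext i
  refine Fin.cases ?_ (fun i => ?_) i <;> simp [intVec]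

/-- The averaging is done in two stages. Averaging over the shift of the constant coefficient
produces Kac–Rice integrals over `I`, and averaging over the other shifts produces the integral over
all tails. Thus the root count needs to be integrable only along lines, never jointly. -/
theorem abs_sum_cubeCount_sub_integral_le {n : ℕ} (hn : 1 ≤ n) {Q : ℝ} (hQ : 0 < Q) {I : Set ℝ}
    (hI : I.OrdConnected) :
    |∑ k ∈ latticeBox (n + 1) ⌈Q⌉₊, cubeCount Q I (intVec k) -
      Q ^ (n + 1) * ∫ t in I, density n t| ≤
      (n + 1) * (2 * (2 * n + 3) * (2 * ⌈Q⌉₊ + 1) ^ n) := by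
  set M := ∑ k ∈ latticeBox (n + 1) ⌈Q⌉₊, cubeCount Q I (intVec k)
  set C : ℝ := (n + 1) * (2 * (2 * n + 3) * (2 * ⌈Q⌉₊ + 1) ^ n)
  have hsub : ∀ q : Fin n → ℝ, ∀ x : ℤ,
      IntegrableOn (fun a : ℝ => cubeCount Q I (Fin.cons (x + a) q)) (Set.Ico 0 1) := fun q x =>
    ((integrable_cubeCount_cons Q hI q).comp_add_left (x : ℝ)).integrableOn
  have h1 : ∀ s ∈ unitCube n,
      |M - ∑ r ∈ latticeBox n ⌈Q⌉₊, ∫ t in I, kernel Q (intVec r + s) t| ≤ C := by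
    intro s hs
    have h2 : ∑ r ∈ latticeBox n ⌈Q⌉₊, ∫ t in I, kernel Q (intVec r + s) t =
        ∫ a in Set.Ico (0 : ℝ) 1, ∑ r ∈ latticeBox n ⌈Q⌉₊,
          ∑ x ∈ Finset.Icc (-(⌈Q⌉₊ : ℤ)) ⌈Q⌉₊, cubeCount Q I (Fin.cons (x + a) (intVec r + s)) := by
      rw [integral_finsetSum _ fun r _ => integrable_finsetSum _ fun x _ => hsub _ x]
      refine Finset.sum_congr rfl fun r _ => ?_
      rw [integral_finsetSum _ fun x _ => hsub _ x, ← integral_cubeCount_cons Q hI]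
      refine integral_eq_sum_Ico (integrable_cubeCount_cons Q hI _) fun x hx => ?_
      by_contra h
      exact hx (Set.indicator_of_notMem (fun h' => h (cons_mem_cube.1 h').1) _)
    rw [h2]
    refine abs_sub_setIntegral_le (by simp)
      (integrable_finsetSum _ fun r _ => integrable_finsetSum _ fun x _ => hsub _ x) fun a ha => ?_
    have h3 := abs_sum_cubeCount_sub_le Q hI ⌈Q⌉₊ (s := (Fin.cons a s : Fin (n + 1) → ℝ))
      (Fin.cases ha.1 fun i => (hs i trivial).1) (Fin.cases ha.2.le fun i => (hs i trivial).2.le)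
    rw [sum_latticeBox_succ 0 
      (fun k => cubeCount Q I (intVec k + (Fin.cons a s : Fin (n + 1) → ℝ)))] at h3
    simpa only [Fin.insertNth_zero', intVec_cons_add] using h3
  have hint : Integrable fun q : Fin n → ℝ => ∫ t in I, kernel Q q t :=
    (integrable_kernel_prod hn hQ I).integral_prod_left
  rw [← integral_integral_kernel hn hQ I, integral_eq_sum_unitCube hint (Q := Q),
    ← integral_finsetSum _ fun r _ => (hint.comp_add_left (intVec r)).integrableOn]
  · exact abs_sub_setIntegral_le (volume_unitCube n)
      (integrable_finsetSum _ fun r _ => (hint.comp_add_left (intVec r)).integrableOn) h1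
  · intro q hq
    by_contra h
    refine hq ?_
    have : ∀ t, kernel Q q t = 0 := fun t => if_neg fun h' => h (mem_cube.2 h'.1)
    simp [this]

/-- The total number of roots in `I` of the integral polynomials of degree at most `n` and height
at most `B`. -/
def latticeCount (n B : ℕ) (I : Set ℝ) : ℝ :=
  ∑ k ∈ latticeBox (n + 1) B, (rootCount I (intVec k) : ℝ)

theorem latticeCount_zero (n : ℕ) (I : Set ℝ) : latticeCount n 0 I = 0 := by
  refine Finset.sum_eq_zero fun k hk => ?_
  have : intVec k = 0 := by
    ext i
    have := mem_latticeBox.1 hk i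
    simp only [Nat.cast_zero, abs_nonpos_iff] at this
    simp [intVec, this]
  rw [this, rootCount_zero, Nat.cast_zero]

/-- The box of size `⌈Q⌉₊` is needed for its unit cells to cover the real cube; its extra lattice
points lie outside that cube and contribute `0`. -/
theorem sum_cubeCount_eq {n : ℕ} {Q : ℝ} (hQ : 0 ≤ Q) (I : Set ℝ) :
    ∑ k ∈ latticeBox (n + 1) ⌈Q⌉₊, cubeCount Q I (intVec k) = latticeCount n ⌊Q⌋₊ I := by
  have hiff : ∀ k : Fin (n + 1) → ℤ, k ∈ latticeBox (n + 1) ⌊Q⌋₊ ↔ intVec k ∈ cube (n + 1) Q := by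
    intro k
    rw [mem_latticeBox, mem_cube]
    refine forall_congr' fun i => ?_
    rw [Int.abs_eq_natAbs, Nat.cast_le, Nat.le_floor_iff hQ, intVec, Nat.cast_natAbs, Int.cast_abs]
  have hsub : latticeBox (n + 1) ⌊Q⌋₊ ⊆ latticeBox (n + 1) ⌈Q⌉₊ := fun k hk => by
    rw [mem_latticeBox] at hk ⊢
    exact fun i => (hk i).trans (by exact_mod_cast Nat.floor_le_ceil Q)
  rw [latticeCount, ← Finset.sum_subset hsub]
  · exact Finset.sum_congr rfl fun k hk => Set.indicator_of_mem ((hiff k).1 hk) _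
  · exact fun k _ hk => Set.indicator_of_notMem (fun h => hk ((hiff k).2 h)) _

theorem exists_abs_latticeCount_sub_le {n : ℕ} (hn : 1 ≤ n) :
    ∃ C : ℝ, ∀ I : Set ℝ, I.OrdConnected → ∀ Q : ℝ, 0 < Q →
      |latticeCount n ⌊Q⌋₊ I - Q ^ (n + 1) * ∫ t in I, density n t| ≤ C * Q ^ n := by
  have hφ : ∀ I : Set ℝ, 0 ≤ ∫ t in I, density n t := fun I =>
    integral_nonneg fun t => density_nonneg t
  -- For `Q ≥ 1`, `2 * ⌈Q⌉₊ + 1 ≤ 5 * Q`. The second summand handles `Q < 1`, where only the zero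
  -- vector is counted; the Möbius sum evaluates the estimate at such arguments `Q / d`.
  refine ⟨(n + 1) * (2 * (2 * n + 3) * 5 ^ n) + ∫ t, density n t, fun I hI Q hQ => ?_⟩
  have hle : ∫ t in I, density n t ≤ ∫ t, density n t :=
    setIntegral_le_integral (integrable_density hn) (ae_of_all _ fun t => density_nonneg t)
  have h0 : 0 ≤ ∫ t, density n t := (hφ I).trans hle
  rcases lt_or_ge Q 1 with h | h
  · have h1 : latticeCount n ⌊Q⌋₊ I = 0 := by
      rw [Nat.floor_eq_zero.2 h, latticeCount_zero]
    rw [h1, zero_sub, abs_neg, abs_of_nonneg (mul_nonneg (by positivity) (hφ I))]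
    calc Q ^ (n + 1) * ∫ t in I, density n t ≤ Q ^ n * ∫ t, density n t := by
          refine mul_le_mul ?_ hle (hφ I) (by positivity)
          exact pow_le_pow_of_le_one hQ.le h.le (Nat.le_succ n)
      _ ≤ _ := by
          rw [add_mul, mul_comm (Q ^ n)]
          have : 0 ≤ (n + 1) * (2 * (2 * (n : ℝ) + 3) * 5 ^ n) * Q ^ n := by positivity
          linarith
  · rw [← sum_cubeCount_eq hQ.le]
    refine (abs_sum_cubeCount_sub_integral_le hn hQ hI).trans ?_
    have h2 : (⌈Q⌉₊ : ℝ) ≤ Q + 1 := (Nat.ceil_lt_add_one hQ.le).le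
    calc (n + 1) * (2 * (2 * (n : ℝ) + 3) * (2 * ⌈Q⌉₊ + 1) ^ n)
        ≤ (n + 1) * (2 * (2 * (n : ℝ) + 3) * (5 * Q) ^ n) := by
          gcongr
          linarith
      _ = (n + 1) * (2 * (2 * (n : ℝ) + 3) * 5 ^ n) * Q ^ n := by rw [mul_pow]; ring
      _ ≤ _ := by
          rw [add_mul]
          have : 0 ≤ (∫ t, density n t) * Q ^ n := mul_nonneg h0 (by positivity)
          linarith

/-! ### Primitive polynomials -/

theorem zeta_mul_tsum_moebius {n : ℕ} (hn : 1 ≤ n) :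
    Summable (fun d : ℕ => (ArithmeticFunction.moebius d : ℝ) / (d : ℝ) ^ (n + 1)) ∧
    (riemannZeta ((n : ℂ) + 1)).re *
      ∑' d : ℕ, (ArithmeticFunction.moebius d : ℝ) / (d : ℝ) ^ (n + 1) = 1 := by
  have hs : 1 < ((n : ℂ) + 1).re := by
    simp only [Complex.add_re, Complex.natCast_re, Complex.one_re]
    have : (1 : ℝ) ≤ n := by exact_mod_cast hn
    linarith
  -- The terms of the Dirichlet series are real, so its identity with the inverse of zeta descends
  -- to a real series.
  have hterm : ∀ d : ℕ, LSeries.term (fun d => (ArithmeticFunction.moebius d : ℂ)) ((n : ℂ) + 1) d =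
      (((ArithmeticFunction.moebius d : ℝ) / (d : ℝ) ^ (n + 1) : ℝ) : ℂ) := fun d => by
    rw [LSeries.term_def]
    split_ifs with hd
    · simp [hd]
    · have : (n : ℂ) + 1 = ((n + 1 : ℕ) : ℂ) := by push_cast; rfl
      rw [this, Complex.cpow_natCast]
      push_cast
      rfl
  have hsum := ArithmeticFunction.LSeriesSummable_moebius_iff.2 hs
  rw [LSeriesSummable, funext hterm, Complex.summable_ofReal] at hsum
  refine ⟨hsum, ?_⟩
  have h1 := ArithmeticFunction.LSeries_zeta_mul_Lseries_moebius hs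
  rw [ArithmeticFunction.LSeries_zeta_eq_riemannZeta hs, LSeries, funext hterm,
    ← Complex.ofReal_tsum] at h1
  have := congrArg Complex.re h1
  simpa using this

theorem zeta_re_ne_zero {n : ℕ} (hn : 1 ≤ n) : (riemannZeta ((n : ℂ) + 1)).re ≠ 0 := fun h => by
  have := (zeta_mul_tsum_moebius hn).2
  rw [h, zero_mul] at this
  exact zero_ne_one this

theorem hasSum_moebius {n : ℕ} (hn : 1 ≤ n) :
    HasSum (fun d : ℕ => (ArithmeticFunction.moebius d : ℝ) / (d : ℝ) ^ (n + 1))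
      (1 / (riemannZeta ((n : ℂ) + 1)).re) := by
  obtain ⟨h1, h2⟩ := zeta_mul_tsum_moebius hn
  convert h1.hasSum using 1
  rw [div_eq_iff (zeta_re_ne_zero hn), mul_comm, h2]

theorem dvd_content_ofCoeffs {m : ℕ} {k : Fin m → ℤ} {d : ℤ} :
    d ∣ (ofCoeffs k).content ↔ ∀ i, d ∣ k i := by
  rw [dvd_content_iff_C_dvd, C_dvd_iff_dvd_coeff]
  constructor
  · exact fun h i => by simpa [coeff_ofCoeffs] using h i
  · intro h i
    by_cases hi : i < m
    · have := h ⟨i, hi⟩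
      rwa [← coeff_ofCoeffs k ⟨i, hi⟩] at this
    · rw [coeff_ofCoeffs_of_le k (not_lt.1 hi)]; exact dvd_zero _

theorem sum_divisors_moebius (m : ℕ) :
    ∑ d ∈ m.divisors, (ArithmeticFunction.moebius d : ℝ) = if m = 1 then 1 else 0 := by
  have h := congrArg (fun f : ArithmeticFunction ℤ => (f m : ℝ))
    ArithmeticFunction.moebius_mul_coe_zeta
  simp only [ArithmeticFunction.coe_mul_zeta_apply, ArithmeticFunction.one_apply] at h
  push_cast at h
  exact h

theorem sum_dvd_latticeBox {m B d : ℕ} (hd : 0 < d) (f : (Fin m → ℤ) → ℝ)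
    (hf : ∀ k, f ((d : ℤ) • k) = f k) :
    ∑ k ∈ latticeBox m B with ∀ i, (d : ℤ) ∣ k i, f k = ∑ k ∈ latticeBox m (B / d), f k := by
  have hd' : (0 : ℤ) < d := by exact_mod_cast hd
  symm
  refine Finset.sum_bij (fun k _ => (d : ℤ) • k) ?_ ?_ ?_ fun k _ => (hf k).symm
  · intro k hk
    rw [Finset.mem_filter, mem_latticeBox]
    refine ⟨fun i => ?_, fun i => ⟨k i, rfl⟩⟩
    have h1 := mem_latticeBox.1 hk i
    rw [Pi.smul_apply, smul_eq_mul, abs_mul, abs_of_pos hd', mul_comm]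
    push_cast at h1
    exact (Int.le_ediv_iff_mul_le hd').1 h1
  · intro k _ l _ h
    ext i
    have := congrFun h i
    simpa [hd.ne'] using this
  · intro k hk
    obtain ⟨h1, h2⟩ := Finset.mem_filter.1 hk
    choose l hl using h2
    refine ⟨l, mem_latticeBox.2 fun i => ?_, funext fun i => (hl i).symm⟩
    have := mem_latticeBox.1 h1 i
    rw [hl i, abs_mul, abs_of_pos hd', mul_comm] at this
    push_cast
    exact (Int.le_ediv_iff_mul_le hd').2 this

-- Möbius inversion over the content: a nonzero vector is primitive exactly when the Möbius sum over
-- the divisors of its content is `1`, and the multiples of `d` in the box form a scaled copy of the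
-- box of size `B / d`.
open Classical in
theorem sum_primitive_eq {m B : ℕ} (f : (Fin m → ℤ) → ℝ)
    (hf : ∀ (d : ℕ) (k : Fin m → ℤ), 0 < d → f ((d : ℤ) • k) = f k) (hf0 : f 0 = 0) :
    ∑ k ∈ latticeBox m B with (ofCoeffs k).IsPrimitive, f k =
      ∑ d ∈ Finset.Icc 1 B, (ArithmeticFunction.moebius d : ℝ) *
        ∑ k ∈ latticeBox m (B / d), f k := by
  have h1 : ∀ k ∈ latticeBox m B, (if (ofCoeffs k).IsPrimitive then f k else 0) =
      ∑ d ∈ Finset.Icc 1 B, (ArithmeticFunction.moebius d : ℝ) *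
        if ∀ i, (d : ℤ) ∣ k i then f k else 0 := by
    intro k hk
    by_cases hk0 : k = 0
    · subst hk0; simp [hf0]
    obtain ⟨i, hi⟩ := Function.ne_iff.1 hk0
    have hc : (ofCoeffs k).content ≠ 0 := by
      rw [Ne, content_eq_zero_iff]
      intro h
      exact hk0 (ofCoeffs_injective (h.trans ofCoeffs_zero.symm))
    have hdiv : (Finset.Icc 1 B).filter (fun d : ℕ => ∀ i, (d : ℤ) ∣ k i) =
        (ofCoeffs k).content.natAbs.divisors := by
      ext d
      rw [Finset.mem_filter, Finset.mem_Icc, Nat.mem_divisors, ← dvd_content_ofCoeffs,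
        ← Int.natCast_dvd]
      constructor
      · rintro ⟨_, h⟩
        exact ⟨h, by simpa using hc⟩
      · rintro ⟨h, -⟩
        refine ⟨?_, h⟩
        have h2 : (d : ℤ) ∣ k i := dvd_content_ofCoeffs.1 h i
        have h3 : (d : ℤ) ∣ |k i| := (dvd_abs _ _).2 h2
        have h4 : 0 < |k i| := abs_pos.2 hi
        have h5 := Int.le_of_dvd h4 h3
        have h6 := mem_latticeBox.1 hk i
        have h7 : d ≠ 0 := by
          rintro rfl
          exact hi (by simpa using h2)
        omega
    have hprim : (ofCoeffs k).IsPrimitive ↔ (ofCoeffs k).content.natAbs = 1 := by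
      rw [isPrimitive_iff_content_eq_one]
      constructor
      · intro h; rw [h]; rfl
      · intro h
        have h0 : (ofCoeffs k).content = normalize (ofCoeffs k).content :=
          normalize_content.symm
        rw [h0, ← Int.abs_eq_normalize, Int.abs_eq_natAbs, h]; rfl
    simp only [mul_ite, mul_zero]
    rw [← Finset.sum_filter, hdiv, ← Finset.sum_mul, sum_divisors_moebius]
    simp only [hprim, ite_mul, one_mul, zero_mul]
  rw [Finset.sum_filter, Finset.sum_congr rfl h1, Finset.sum_comm]
  refine Finset.sum_congr rfl fun d hd => ?_
  rw [← Finset.mul_sum, ← Finset.sum_filter,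
    sum_dvd_latticeBox (Finset.mem_Icc.1 hd).1 f fun k => hf d k (Finset.mem_Icc.1 hd).1]

open Classical in
/-- The total number of roots in `I` of the primitive integral polynomials of degree at most `n`
and height at most `B`. -/
def primitiveCount (n B : ℕ) (I : Set ℝ) : ℝ :=
  ∑ k ∈ latticeBox (n + 1) B with (ofCoeffs k).IsPrimitive, (rootCount I (intVec k) : ℝ)

theorem intVec_smul {m : ℕ} (d : ℤ) (k : Fin m → ℤ) : intVec (d • k) = (d : ℝ) • intVec k := by
  ext i; simp [intVec]

theorem primitiveCount_eq (n B : ℕ) (I : Set ℝ) :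
    primitiveCount n B I =
      ∑ d ∈ Finset.Icc 1 B, (ArithmeticFunction.moebius d : ℝ) * latticeCount n (B / d) I := by
  refine sum_primitive_eq (fun k => (rootCount I (intVec k) : ℝ)) (fun d k hd => ?_) ?_
  · rw [intVec_smul, rootCount_smul]
    exact_mod_cast hd.ne'
  · have : intVec (0 : Fin (n + 1) → ℤ) = 0 := by ext; simp [intVec]
    rw [this, rootCount_zero, Nat.cast_zero]

/-- The errors `(Q / d) ^ n` sum to `O(Q ^ n)` because `∑ 1 / d ^ n` converges for `n ≥ 2`. -/
theorem exists_abs_primitiveCount_sub_le {n : ℕ} (hn : 2 ≤ n) :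
    ∃ C : ℝ, ∀ I : Set ℝ, I.OrdConnected → ∀ Q : ℝ, 0 < Q →
      |primitiveCount n ⌊Q⌋₊ I -
        Q ^ (n + 1) / (riemannZeta ((n : ℂ) + 1)).re * ∫ t in I, density n t| ≤ C * Q ^ n := by
  obtain ⟨C, hC⟩ := exists_abs_latticeCount_sub_le (n := n) (by omega)
  have hsum : Summable fun d : ℕ => 1 / (d : ℝ) ^ n := Real.summable_one_div_nat_pow.2 (by omega)
  refine ⟨C * ∑' d : ℕ, 1 / (d : ℝ) ^ n, fun I hI Q hQ => ?_⟩
  set V := ∫ t in I, density n t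
  -- The sum may run over all `d`: the Möbius function vanishes at `0`, and for `d > ⌊Q⌋₊` the box
  -- of size `⌊Q⌋₊ / d = 0` contains only the zero vector.
  have h1 : HasSum (fun d : ℕ => (ArithmeticFunction.moebius d : ℝ) * latticeCount n (⌊Q⌋₊ / d) I)
      (primitiveCount n ⌊Q⌋₊ I) := by
    rw [primitiveCount_eq]
    refine hasSum_sum_of_ne_finset_zero fun d hd => ?_
    rw [Finset.mem_Icc, not_and_or, not_le, not_le] at hd
    rcases hd with hd | hd
    · have : d = 0 := by omega
      subst this; simp
    · rw [Nat.div_eq_of_lt hd, latticeCount_zero, mul_zero]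
  have h2 := (hasSum_moebius (n := n) (by omega)).mul_right (Q ^ (n + 1) * V)
  have h3 := h1.sub h2
  have h4 := tsum_of_norm_bounded (hsum.hasSum.mul_left (C * Q ^ n)) (fun d : ℕ => ?_)
    (f := fun d : ℕ => (ArithmeticFunction.moebius d : ℝ) * latticeCount n (⌊Q⌋₊ / d) I -
      (ArithmeticFunction.moebius d : ℝ) / (d : ℝ) ^ (n + 1) * (Q ^ (n + 1) * V))
  · rw [h3.tsum_eq, Real.norm_eq_abs] at h4
    calc _ = |primitiveCount n ⌊Q⌋₊ I -
          1 / (riemannZeta ((n : ℂ) + 1)).re * (Q ^ (n + 1) * V)| := by congr 2; ring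
      _ ≤ _ := h4
      _ = _ := by ring
  · rcases Nat.eq_zero_or_pos d with rfl | hd
    · have : n ≠ 0 := by omega
      simp [this]
    have hd' : (0 : ℝ) < d := by exact_mod_cast hd
    have h5 := hC I hI (Q / d) (by positivity)
    rw [Nat.floor_div_natCast] at h5
    have h6 : |(ArithmeticFunction.moebius d : ℝ)| ≤ 1 := by
      exact_mod_cast ArithmeticFunction.abs_moebius_le_one
    have h7 : (ArithmeticFunction.moebius d : ℝ) * latticeCount n (⌊Q⌋₊ / d) I -
      (ArithmeticFunction.moebius d : ℝ) / (d : ℝ) ^ (n + 1) * (Q ^ (n + 1) * V) =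
      (ArithmeticFunction.moebius d : ℝ) * (latticeCount n (⌊Q⌋₊ / d) I -
        (Q / d) ^ (n + 1) * V) := by rw [div_pow]; ring
    rw [h7, Real.norm_eq_abs, abs_mul]
    calc _ ≤ 1 * (C * (Q / d) ^ n) := mul_le_mul h6 h5 (abs_nonneg _) zero_le_one
      _ = _ := by rw [div_pow]; ring

/-! ### Algebraic numbers and irreducible polynomials -/

theorem isUnit_of_isPrimitive_of_dvd {p b : ℤ[X]} (hp : p.IsPrimitive) (hb : b ∣ p)
    (h : b.natDegree = 0) : IsUnit b := by
  rw [eq_C_of_natDegree_eq_zero h] at hb ⊢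
  exact isUnit_C.2 (hp _ hb)

/-- In a factorization one factor vanishes at `α` and so has full degree; the other is a constant
dividing a primitive polynomial, hence a unit. -/
theorem IsMinimalPolynomial.irreducible {p : ℤ[X]} {α : ℝ} (hp : IsMinimalPolynomial p α) :
    Irreducible p := by
  obtain ⟨h0, hα, hmin, hprim⟩ := hp
  refine ⟨fun hu => ?_, fun a b hab => ?_⟩
  · have h1 := eq_C_of_natDegree_eq_zero (natDegree_eq_zero_of_isUnit hu)
    rw [h1, aeval_C] at hα
    have : p.coeff 0 = 0 := by simpa using hα
    rw [this, map_zero] at h1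
    exact h0 h1
  · have ha0 : a ≠ 0 := by rintro rfl; simp at hab; exact h0 hab
    have hb0 : b ≠ 0 := by rintro rfl; simp at hab; exact h0 hab
    have hdeg : p.natDegree = a.natDegree + b.natDegree := by rw [hab, natDegree_mul ha0 hb0]
    rw [hab, map_mul] at hα
    rcases mul_eq_zero.1 hα with h | h
    · have := hmin a ha0 h
      exact Or.inr (isUnit_of_isPrimitive_of_dvd hprim ⟨a, by rw [hab, mul_comm]⟩ (by omega))
    · have := hmin b hb0 h
      exact Or.inl (isUnit_of_isPrimitive_of_dvd hprim ⟨b, hab⟩ (by omega))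

theorem aeval_map_intCast (p : ℤ[X]) (α : ℝ) :
    aeval α (p.map (Int.castRingHom ℚ)) = aeval α p :=
  aeval_map_algebraMap ℚ α p

/-- Gauss's lemma: an irreducible integral polynomial of positive degree stays irreducible over `ℚ`.
-/
theorem minpoly_eq_of_irreducible {p : ℤ[X]} {α : ℝ} (hp : Irreducible p) (hd : p.natDegree ≠ 0)
    (hα : aeval α p = 0) : ∃ c : ℚ, c ≠ 0 ∧ minpoly ℚ α = p.map (Int.castRingHom ℚ) * C c := by
  have hirr := (IsPrimitive.Int.irreducible_iff_irreducible_map_cast (hp.isPrimitive hd)).1 hp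
  refine ⟨_, ?_, (minpoly.eq_of_irreducible hirr ((aeval_map_intCast p α).trans hα)).symm⟩
  exact inv_ne_zero (leadingCoeff_ne_zero.2 hirr.ne_zero)

theorem natDegree_map_intCast (p : ℤ[X]) : (p.map (Int.castRingHom ℚ)).natDegree = p.natDegree :=
  natDegree_map_eq_of_injective (RingHom.injective_int _) p

theorem isMinimalPolynomial_of_irreducible {p : ℤ[X]} {α : ℝ} (hp : Irreducible p)
    (hd : p.natDegree ≠ 0) (hα : aeval α p = 0) : IsMinimalPolynomial p α := by
  refine ⟨hp.ne_zero, hα, fun q hq hqα => ?_, hp.isPrimitive hd⟩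
  obtain ⟨c, hc, h⟩ := minpoly_eq_of_irreducible hp hd hα
  have h1 : (minpoly ℚ α).natDegree = p.natDegree := by
    rw [h, natDegree_mul_C hc, natDegree_map_intCast]
  have h2 : q.map (Int.castRingHom ℚ) ≠ 0 :=
    (Polynomial.map_ne_zero_iff (RingHom.injective_int _)).2 hq
  rw [← h1, ← natDegree_map_intCast q]
  exact natDegree_le_of_dvd (minpoly.dvd ℚ α ((aeval_map_intCast q α).trans hqα)) h2

theorem eq_or_eq_neg_of_common_root {p q : ℤ[X]} {α : ℝ} (hp : Irreducible p) (hq : Irreducible q)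
    (hpd : p.natDegree ≠ 0) (hpα : aeval α p = 0) (hqα : aeval α q = 0) :
    q = p ∨ q = -p := by
  obtain ⟨c, hc, h⟩ := minpoly_eq_of_irreducible hp hpd hpα
  have h1 : p.map (Int.castRingHom ℚ) ∣ q.map (Int.castRingHom ℚ) :=
    (Dvd.intro _ h.symm).trans (minpoly.dvd ℚ α ((aeval_map_intCast q α).trans hqα))
  have h2 : p ∣ q := (IsPrimitive.Int.dvd_iff_map_cast_dvd_map_cast p q (hp.isPrimitive hpd)).2 h1
  obtain ⟨u, hu⟩ := hp.associated_of_dvd hq h2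
  obtain ⟨r, hr, hr'⟩ := Polynomial.isUnit_iff.1 u.isUnit
  rw [← hr'] at hu
  rcases Int.isUnit_iff.1 hr with rfl | rfl
  · left; rw [← hu]; simp
  · right; rw [← hu]; simp

theorem height_le_iff {p : ℤ[X]} {B : ℕ} : height p ≤ B ↔ ∀ i, |p.coeff i| ≤ B := by
  rw [height, Finset.sup_le_iff]
  constructor
  · intro h i
    by_cases hi : i ∈ p.support
    · have := h i hi
      rw [Int.abs_eq_natAbs]
      exact_mod_cast this
    · rw [notMem_support_iff.1 hi]; simp
  · intro h i _
    have := h i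
    rw [Int.abs_eq_natAbs] at this
    exact_mod_cast this

theorem aeval_ofCoeffs_eq {m : ℕ} (k : Fin m → ℤ) (α : ℝ) :
    aeval α (ofCoeffs k) = (ofCoeffs (intVec k)).eval α := by
  have : ofCoeffs (intVec k) = (ofCoeffs k).map (algebraMap ℤ ℝ) := by
    rw [map_ofCoeffs]; rfl
  rw [this, eval_map_algebraMap]

theorem ofCoeffs_mem {n B : ℕ} {k : Fin (n + 1) → ℤ} :
    k ∈ latticeBox (n + 1) B ↔ height (ofCoeffs k) ≤ B := by
  rw [mem_latticeBox, height_le_iff]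
  constructor
  · intro h i
    by_cases hi : i < n + 1
    · have := h ⟨i, hi⟩
      rwa [← coeff_ofCoeffs k ⟨i, hi⟩] at this
    · rw [coeff_ofCoeffs_of_le k (not_lt.1 hi)]; simp
  · intro h i
    rw [← coeff_ofCoeffs k i]
    exact h i

theorem ofCoeffs_neg {m : ℕ} (k : Fin m → ℤ) : ofCoeffs (-k) = -ofCoeffs k := by
  simp [ofCoeffs]

open Classical in
/-- The coefficient vectors of the irreducible integral polynomials of degree `n` and height at
most `B`. -/
def irreducibleBox (n B : ℕ) : Finset (Fin (n + 1) → ℤ) :=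
  (latticeBox (n + 1) B).filter fun k =>
    Irreducible (ofCoeffs k) ∧ (ofCoeffs k).natDegree = n

theorem mem_irreducibleBox {n B : ℕ} {k : Fin (n + 1) → ℤ} : k ∈ irreducibleBox n B ↔
    height (ofCoeffs k) ≤ B ∧ Irreducible (ofCoeffs k) ∧ (ofCoeffs k).natDegree = n := by
  classical
  rw [irreducibleBox, Finset.mem_filter, ofCoeffs_mem]

theorem ne_zero_of_isMinimalPolynomial {p : ℤ[X]} {α : ℝ} (hp : IsMinimalPolynomial p α)
    (hd : 2 ≤ p.natDegree) : α ≠ 0 := by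
  rintro rfl
  have := hp.2.2.1 X X_ne_zero (by simp)
  rw [natDegree_X] at this
  omega

/-- Double counting of the pairs of an irreducible polynomial and one of its roots in `I`. That
`rootCount` ignores `0` is harmless, since `0` has degree `1 < n`. -/
theorem two_mul_count {n : ℕ} (hn : 2 ≤ n) {Q : ℝ} (hQ : 0 ≤ Q) (I : Set ℝ) :
    2 * count n Q I = ∑ k ∈ irreducibleBox n ⌊Q⌋₊, rootCount I (intVec k) := by
  classical
  have hfin : (algebraicNumbers n Q ∩ I).Finite := (finite_algebraicNumbers n Q).inter_of_left I
  set A := hfin.toFinset with hA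
  have hroot : ∀ k ∈ irreducibleBox n ⌊Q⌋₊, rootCount I (intVec k) =
      (A.filter fun α => aeval α (ofCoeffs k) = 0).card := by
    intro k hk
    obtain ⟨h1, h2, h3⟩ := mem_irreducibleBox.1 hk
    rw [rootCount]
    congr 1
    ext α
    have hne : ofCoeffs (intVec k) ≠ 0 := by
      rw [← ofCoeffs_zero]
      intro h
      refine h2.ne_zero ?_
      rw [← ofCoeffs_zero (m := n + 1)]
      congr 1
      ext i
      have := congrFun (ofCoeffs_injective h) i
      simpa [intVec] using this
    rw [Finset.mem_filter, Finset.mem_filter, Multiset.mem_toFinset, mem_roots hne, IsRoot.def,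
      ← aeval_ofCoeffs_eq, hA, Set.Finite.mem_toFinset, Set.mem_inter_iff]
    constructor
    · rintro ⟨h4, h5, -⟩
      exact ⟨⟨⟨_, isMinimalPolynomial_of_irreducible h2 (by omega) h4, h3,
        (Nat.le_floor_iff hQ).1 h1⟩, h5⟩, h4⟩
    · rintro ⟨⟨_, h5⟩, h4⟩
      exact ⟨h4, h5, ne_zero_of_isMinimalPolynomial
        (isMinimalPolynomial_of_irreducible h2 (by omega) h4) (by omega)⟩
  rw [Finset.sum_congr rfl hroot]
  have hswap := Finset.sum_card_bipartiteAbove_eq_sum_card_bipartiteBelow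
    (s := irreducibleBox n ⌊Q⌋₊) (t := A) (fun k α => aeval α (ofCoeffs k) = 0)
  simp only [Finset.bipartiteAbove, Finset.bipartiteBelow] at hswap
  rw [hswap]
  have htwo : ∀ α ∈ A, ((irreducibleBox n ⌊Q⌋₊).filter
      fun k => aeval α (ofCoeffs k) = 0).card = 2 := by
    intro α hα
    rw [hA, Set.Finite.mem_toFinset] at hα
    obtain ⟨⟨p, hp, hd, hh⟩, -⟩ := hα
    let k₀ : Fin (n + 1) → ℤ := fun i => p.coeff i
    have hk₀ : ofCoeffs k₀ = p := ofCoeffs_coeff hd.le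
    have hneg : height (-p) = height p := by simp [height]
    have hset : (irreducibleBox n ⌊Q⌋₊).filter (fun k => aeval α (ofCoeffs k) = 0) =
        {k₀, -k₀} := by
      ext k
      rw [Finset.mem_filter, mem_irreducibleBox, Finset.mem_insert, Finset.mem_singleton]
      constructor
      · rintro ⟨⟨-, h2, h3⟩, h4⟩
        rcases eq_or_eq_neg_of_common_root hp.irreducible h2 (by omega) hp.2.1 h4
          with h | h
        · left; exact ofCoeffs_injective (h.trans hk₀.symm)
        · right; refine ofCoeffs_injective (h.trans ?_)
          rw [ofCoeffs_neg, hk₀]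
      · rintro (rfl | rfl)
        · rw [hk₀]
          exact ⟨⟨Nat.le_floor hh, hp.irreducible, hd⟩, hp.2.1⟩
        · rw [ofCoeffs_neg, hk₀, hneg, natDegree_neg, map_neg, hp.2.1, neg_zero]
          exact ⟨⟨Nat.le_floor hh, (Associated.neg_right_iff.2 (Associated.refl p)).irreducible hp.irreducible, hd⟩, rfl⟩
    rw [hset, Finset.card_pair]
    intro h
    have : p = -p := by
      conv_lhs => rw [← hk₀, h, ofCoeffs_neg, hk₀]
    exact hp.1 (self_eq_neg.1 this)
  rw [Finset.sum_congr rfl htwo, Finset.sum_const, smul_eq_mul, mul_comm, count,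
    Set.ncard_eq_toFinset_card _ hfin]

open Classical in
/-- The coefficient vectors of the integral polynomials of degree `n` and height at most `B` that
are products of polynomials of positive degree. -/
def reducibleBox (n B : ℕ) : Finset (Fin (n + 1) → ℤ) :=
  (latticeBox (n + 1) B).filter fun k => (ofCoeffs k).natDegree = n ∧
    ∃ a b : ℤ[X], ofCoeffs k = a * b ∧ 1 ≤ a.natDegree ∧ a.natDegree ≤ b.natDegree

/-- For a primitive polynomial of positive degree, nonunit factors have positive degree, so
reducibility is a genuine splitting of the degree. -/
theorem primitive_mem_union {n B : ℕ} (hn : 1 ≤ n) {k : Fin (n + 1) → ℤ}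
    (hk : k ∈ latticeBox (n + 1) B) (hp : (ofCoeffs k).IsPrimitive) (hi : k ∉ irreducibleBox n B) :
    k ∈ (latticeBox (n + 1) B).filter (fun k => k (Fin.last n) = 0) ∪ reducibleBox n B := by
  classical
  rw [Finset.mem_union, Finset.mem_filter, reducibleBox, Finset.mem_filter]
  by_cases h0 : k (Fin.last n) = 0
  · exact Or.inl ⟨hk, h0⟩
  refine Or.inr ⟨hk, ?_⟩
  have hd : (ofCoeffs k).natDegree = n := by
    refine le_antisymm (natDegree_ofCoeffs_le k) (le_natDegree_of_ne_zero ?_)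
    rw [← coeff_ofCoeffs k (Fin.last n)] at h0
    simpa using h0
  refine ⟨hd, ?_⟩
  rw [mem_irreducibleBox, ← ofCoeffs_mem] at hi
  have hirr : ¬ Irreducible (ofCoeffs k) := fun h => hi ⟨hk, h, hd⟩
  have hu : ¬ IsUnit (ofCoeffs k) := fun h => by
    have := natDegree_eq_zero_of_isUnit h
    omega
  rw [irreducible_iff] at hirr
  push Not at hirr
  obtain ⟨a, b, hab, ha, hb⟩ := hirr hu
  have ha' : 1 ≤ a.natDegree := Nat.one_le_iff_ne_zero.2 fun h =>
    ha (isUnit_of_isPrimitive_of_dvd hp ⟨b, hab⟩ h)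
  have hb' : 1 ≤ b.natDegree := Nat.one_le_iff_ne_zero.2 fun h =>
    hb (isUnit_of_isPrimitive_of_dvd hp ⟨a, by rw [hab, mul_comm]⟩ h)
  rcases le_total a.natDegree b.natDegree with h | h
  · exact ⟨a, b, hab, ha', h⟩
  · exact ⟨b, a, by rw [hab, mul_comm], hb', h⟩

theorem card_last_eq_zero (n B : ℕ) :
    ((latticeBox (n + 1) B).filter fun k => k (Fin.last n) = 0).card = (2 * B + 1) ^ n := by
  have h := sum_latticeBox_succ (B := B) (Fin.last n)
    (fun k => if k (Fin.last n) = 0 then (1 : ℝ) else 0)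
  simp only [Fin.insertNth_apply_same, Finset.sum_boole] at h
  have h1 : (Finset.Icc (-(B : ℤ)) B).filter (· = 0) = {0} := by
    ext x
    simp only [Finset.mem_filter, Finset.mem_Icc, Finset.mem_singleton]
    omega
  rw [h1] at h
  simp only [Finset.card_singleton, Nat.cast_one, Finset.sum_const, nsmul_eq_mul, mul_one,
    card_latticeBox] at h
  exact_mod_cast h

/-- Each polynomial that is primitive but not irreducible of degree `n` contributes at most `n`
roots. -/
theorem abs_primitiveCount_sub_le {n : ℕ} (hn : 2 ≤ n) {Q : ℝ} (hQ : 0 ≤ Q) (I : Set ℝ) :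
    |primitiveCount n ⌊Q⌋₊ I - 2 * count n Q I| ≤
      n * ((2 * ⌊Q⌋₊ + 1) ^ n + (reducibleBox n ⌊Q⌋₊).card) := by
  classical
  set B := ⌊Q⌋₊
  have hsub : irreducibleBox n B ⊆
      (latticeBox (n + 1) B).filter fun k => (ofCoeffs k).IsPrimitive := fun k hk => by
    rw [irreducibleBox, Finset.mem_filter] at hk
    rw [Finset.mem_filter]
    exact ⟨hk.1, hk.2.1.isPrimitive (by omega)⟩
  have h2 : (2 : ℝ) * count n Q I = ∑ k ∈ irreducibleBox n B, (rootCount I (intVec k) : ℝ) := by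
    exact_mod_cast two_mul_count hn hQ I
  rw [primitiveCount, h2, ← Finset.sum_sdiff hsub, add_sub_cancel_right,
    abs_of_nonneg (Finset.sum_nonneg fun _ _ => Nat.cast_nonneg _)]
  set R := ((latticeBox (n + 1) B).filter fun k => (ofCoeffs k).IsPrimitive) \ irreducibleBox n B
  have hR : R.card ≤ (2 * B + 1) ^ n + (reducibleBox n B).card := by
    rw [← card_last_eq_zero n B]
    refine (Finset.card_le_card fun k hk => ?_).trans (Finset.card_union_le _ _)
    rw [Finset.mem_sdiff, Finset.mem_filter] at hk
    exact primitive_mem_union (by omega) hk.1.1 hk.1.2 hk.2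
  calc ∑ k ∈ R, (rootCount I (intVec k) : ℝ) ≤ ∑ k ∈ R, (n : ℝ) :=
        Finset.sum_le_sum fun k _ => by exact_mod_cast rootCount_le I (intVec k)
    _ = n * R.card := by rw [Finset.sum_const, nsmul_eq_mul, mul_comm]
    _ ≤ _ := by
        gcongr
        exact_mod_cast hR

/-! ### Reducible polynomials -/

theorem natAbs_coeff_le_height (p : ℤ[X]) (i : ℕ) : (p.coeff i).natAbs ≤ height p := by
  have := height_le_iff.1 (le_refl (height p)) i
  rw [Int.abs_eq_natAbs] at this
  exact_mod_cast this

theorem norm_coeff_map (p : ℤ[X]) (i : ℕ) :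
    ‖(p.map (Int.castRingHom ℂ)).coeff i‖ = (p.coeff i).natAbs := by
  rw [coeff_map, eq_intCast, Complex.norm_intCast, Nat.cast_natAbs, Int.cast_abs]

theorem height_le_mahlerMeasure (p : ℤ[X]) :
    (height p : ℝ) ≤ 2 ^ p.natDegree * (p.map (Int.castRingHom ℂ)).mahlerMeasure := by
  have hM : 0 ≤ (p.map (Int.castRingHom ℂ)).mahlerMeasure := mahlerMeasure_nonneg _
  have h : ∀ i, ((p.coeff i).natAbs : ℝ) ≤
      2 ^ p.natDegree * (p.map (Int.castRingHom ℂ)).mahlerMeasure := fun i => by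
    rw [← norm_coeff_map]
    refine (norm_coeff_le_choose_mul_mahlerMeasure i _).trans ?_
    gcongr
    rw [natDegree_map_eq_of_injective (RingHom.injective_int _)]
    exact_mod_cast Nat.choose_le_two_pow _ _
  have h2 : height p ≤ ⌊2 ^ p.natDegree * (p.map (Int.castRingHom ℂ)).mahlerMeasure⌋₊ := by
    rw [height, Finset.sup_le_iff]
    exact fun i _ => Nat.le_floor (h i)
  exact (Nat.le_floor_iff (by positivity)).1 h2

theorem mahlerMeasure_le_height (p : ℤ[X]) :
    (p.map (Int.castRingHom ℂ)).mahlerMeasure ≤ (p.natDegree + 1) * height p := by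
  refine (mahlerMeasure_le_sum_norm_coeff _).trans ?_
  rw [Polynomial.sum_over_range _ (by simp),
    natDegree_map_eq_of_injective (RingHom.injective_int _)]
  calc _ ≤ ∑ i ∈ Finset.range (p.natDegree + 1), (height p : ℝ) :=
        Finset.sum_le_sum fun i _ => by
          rw [norm_coeff_map]; exact_mod_cast natAbs_coeff_le_height p i
    _ = _ := by rw [Finset.sum_const, Finset.card_range, nsmul_eq_mul]; push_cast; ring

/-- The height is almost multiplicative. -/
theorem height_mul_height_le {a b : ℤ[X]} (ha : a ≠ 0) (hb : b ≠ 0) :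
    height a * height b ≤
      2 ^ (a * b).natDegree * ((a * b).natDegree + 1) * height (a * b) := by
  have h1 := height_le_mahlerMeasure a
  have h2 := height_le_mahlerMeasure b
  have h3 := mahlerMeasure_le_height (a * b)
  rw [Polynomial.map_mul, mahlerMeasure_mul] at h3
  have h4 := mul_le_mul h1 h2 (Nat.cast_nonneg _) (by
    have := mahlerMeasure_nonneg (a.map (Int.castRingHom ℂ)); positivity)
  have h5 : (height a : ℝ) * height b ≤
      2 ^ (a * b).natDegree * (((a * b).natDegree + 1) * height (a * b)) := by
    refine h4.trans ?_
    rw [mul_mul_mul_comm, ← pow_add, ← natDegree_mul ha hb]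
    gcongr
  rw [← mul_assoc] at h5
  exact_mod_cast h5

/-- The integer vectors whose largest entry has absolute value `h`. -/
def latticeSphere (m h : ℕ) : Finset (Fin m → ℤ) := latticeBox m h \ latticeBox m (h - 1)

/-- The count is a difference of `(m + 1)`-st powers of two numbers that differ by `2`. -/
theorem card_latticeSphere_le {m h : ℕ} (hh : 1 ≤ h) :
    ((latticeSphere (m + 1) h).card : ℝ) ≤ 2 * (m + 1) * (2 * h + 1) ^ m := by
  have hsub : latticeBox (m + 1) (h - 1) ⊆ latticeBox (m + 1) h := fun k hk => by
    rw [mem_latticeBox] at hk ⊢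
    intro i
    have := hk i
    omega
  rw [latticeSphere, Finset.card_sdiff_of_subset hsub, Nat.cast_sub (Finset.card_le_card hsub),
    card_latticeBox, card_latticeBox]
  push_cast [Nat.cast_sub hh]
  have h1 := abs_pow_sub_pow_le (2 * (h : ℝ) + 1) (2 * ((h : ℝ) - 1) + 1) (m + 1)
  have hh' : (1 : ℝ) ≤ h := by exact_mod_cast hh
  have h2 : |2 * (h : ℝ) + 1 - (2 * ((h : ℝ) - 1) + 1)| = 2 := by
    rw [show 2 * (h : ℝ) + 1 - (2 * ((h : ℝ) - 1) + 1) = 2 by ring]; norm_num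
  rw [h2, abs_of_nonneg (by linarith : (0 : ℝ) ≤ 2 * h + 1),
    abs_of_nonneg (by linarith : (0 : ℝ) ≤ 2 * ((h : ℝ) - 1) + 1),
    max_eq_left (by linarith)] at h1
  push_cast at h1
  exact (le_abs_self _).trans h1

theorem height_pos {p : ℤ[X]} (hp : p ≠ 0) : 1 ≤ height p := by
  have h := natAbs_coeff_le_height p p.natDegree
  have : p.coeff p.natDegree ≠ 0 := leadingCoeff_ne_zero.2 hp
  omega

/-- A product is recorded by the degree `d ≤ n / 2` of its factor of smaller degree, the exact
height `h` of that factor, and the two coefficient vectors. Almost multiplicativity bounds the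
height of the cofactor by a constant times `B / h`. -/
theorem reducibleBox_subset {n B : ℕ} (hn : 1 ≤ n) :
    reducibleBox n B ⊆ (Finset.Icc 1 (n / 2)).biUnion fun d =>
      (Finset.Icc 1 (2 ^ n * (n + 1) * B)).biUnion fun h =>
        (latticeSphere (d + 1) h ×ˢ latticeBox (n - d + 1) (2 ^ n * (n + 1) * B / h)).image
          fun x => fun i : Fin (n + 1) => (ofCoeffs x.1 * ofCoeffs x.2).coeff i := by
  classical
  intro k hk
  rw [reducibleBox, Finset.mem_filter, ofCoeffs_mem] at hk
  obtain ⟨hB, hd, a, b, hab, ha1, hle⟩ := hk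
  have hk0 : ofCoeffs k ≠ 0 := fun h0 => by rw [h0, natDegree_zero] at hd; omega
  have ha : a ≠ 0 := by rintro rfl; rw [zero_mul] at hab; exact hk0 hab
  have hb : b ≠ 0 := by rintro rfl; rw [mul_zero] at hab; exact hk0 hab
  have hdeg : a.natDegree + b.natDegree = n := by rw [← natDegree_mul ha hb, ← hab, hd]
  have hH := height_mul_height_le ha hb
  rw [← hab, hd] at hH
  have hH2 : height a * height b ≤ 2 ^ n * (n + 1) * B := hH.trans (Nat.mul_le_mul_left _ hB)
  have ha' := height_pos ha
  have hb' := height_pos hb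
  have ea : ofCoeffs (fun i : Fin (a.natDegree + 1) => a.coeff i) = a := ofCoeffs_coeff le_rfl
  have eb : ofCoeffs (fun i : Fin (n - a.natDegree + 1) => b.coeff i) = b :=
    ofCoeffs_coeff (by omega)
  simp only [Finset.mem_biUnion, Finset.mem_Icc, Finset.mem_image, Finset.mem_product]
  refine ⟨a.natDegree, ⟨ha1, by omega⟩, height a, ⟨ha', ?_⟩,
    (fun i => a.coeff i, fun i => b.coeff i), ⟨?_, ?_⟩, ?_⟩
  · exact (Nat.le_mul_of_pos_right _ hb').trans hH2
  · rw [latticeSphere, Finset.mem_sdiff, ofCoeffs_mem, ofCoeffs_mem, ea]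
    omega
  · rw [ofCoeffs_mem, eb, Nat.le_div_iff_mul_le ha', mul_comm]
    exact hH2
  · ext i
    simp only
    rw [ea, eb, ← hab, coeff_ofCoeffs]

/-- Up to constants there are `h ^ d` choices for the first factor and `(X / h) ^ (n - d + 1)` for
the second, with `X = 2 ^ n * (n + 1) * B`. -/
theorem card_reducibleBox_le {n B : ℕ} (hn : 1 ≤ n) :
    ((reducibleBox n B).card : ℝ) ≤ ∑ d ∈ Finset.Icc 1 (n / 2),
      ∑ h ∈ Finset.Icc 1 (2 ^ n * (n + 1) * B),
        2 * (n + 1) * 3 ^ (n + 1) * (((2 ^ n * (n + 1) * B : ℕ) : ℝ) ^ (n - d + 1) /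
          (h : ℝ) ^ (n - d + 1 - d)) := by
  classical
  set X := 2 ^ n * (n + 1) * B
  have h1 : (reducibleBox n B).card ≤ ∑ d ∈ Finset.Icc 1 (n / 2), ∑ h ∈ Finset.Icc 1 X,
      (latticeSphere (d + 1) h).card * (latticeBox (n - d + 1) (X / h)).card := by
    refine (Finset.card_le_card (reducibleBox_subset hn)).trans (Finset.card_biUnion_le.trans ?_)
    refine Finset.sum_le_sum fun d _ => Finset.card_biUnion_le.trans ?_
    refine Finset.sum_le_sum fun h _ => Finset.card_image_le.trans ?_
    rw [Finset.card_product]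
  have h2 : ((reducibleBox n B).card : ℝ) ≤ ∑ d ∈ Finset.Icc 1 (n / 2), ∑ h ∈ Finset.Icc 1 X,
      ((latticeSphere (d + 1) h).card : ℝ) * (latticeBox (n - d + 1) (X / h)).card := by
    exact_mod_cast h1
  refine h2.trans (Finset.sum_le_sum fun d hd => Finset.sum_le_sum fun h hh => ?_)
  rw [Finset.mem_Icc] at hd hh
  have hh1 : (1 : ℝ) ≤ h := by exact_mod_cast hh.1
  have hX : (h : ℝ) ≤ X := by exact_mod_cast hh.2
  have hq : (1 : ℝ) ≤ X / h := by rwa [le_div_iff₀ (by linarith), one_mul]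
  have hbox : ((latticeBox (n - d + 1) (X / h)).card : ℝ) ≤ (3 * (X / h)) ^ (n - d + 1) := by
    rw [card_latticeBox]
    push_cast
    gcongr
    have : ((X / h : ℕ) : ℝ) ≤ (X : ℝ) / h := Nat.cast_div_le
    linarith
  have hsph : ((latticeSphere (d + 1) h).card : ℝ) ≤ 2 * (n + 1) * (3 * h) ^ d := by
    refine (card_latticeSphere_le hh.1).trans ?_
    have : (d : ℝ) ≤ n := by exact_mod_cast (by omega : d ≤ n)
    gcongr
    linarith
  calc _ ≤ (2 * (n + 1) * (3 * h) ^ d : ℝ) * (3 * (X / h)) ^ (n - d + 1) :=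
        mul_le_mul hsph hbox (Nat.cast_nonneg _) (by positivity)
    _ = _ := by
        have e1 : (3 : ℝ) ^ (n + 1) = 3 ^ d * 3 ^ (n - d + 1) := by
          rw [← pow_add]; congr 1; omega
        have e2 : (h : ℝ) ^ (n - d + 1) = h ^ d * h ^ (n - d + 1 - d) := by
          rw [← pow_add]; congr 1; omega
        rw [e1, mul_pow, mul_pow, div_pow, e2]
        have : (h : ℝ) ≠ 0 := by linarith
        field_simp

theorem sum_inv_Icc_le (X : ℕ) : ∑ h ∈ Finset.Icc 1 X, (1 : ℝ) / h ≤ 1 + Real.log X := by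
  have := harmonic_le_one_add_log X
  rw [harmonic_eq_sum_Icc] at this
  push_cast at this
  simpa only [one_div] using this

/-- For `n = 2` only `d = 1` occurs and the exponent of `h` is `1`, so the sum is harmonic. For `n ≥
3` the terms with `d = 1` have exponent at least `2` and sum to `O(X ^ n)`; for `d ≥ 2` each of the
`X` terms is at most `X ^ (n - 1)`. -/
theorem exists_card_reducibleBox_le {n : ℕ} (hn : 2 ≤ n) :
    ∃ C : ℝ, 0 ≤ C ∧ ∀ Q : ℝ, 2 ≤ Q →
      ((reducibleBox n ⌊Q⌋₊).card : ℝ) ≤ C * (Q ^ n * Real.log Q ^ ell n) := by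
  set c : ℝ := 2 ^ n * (n + 1)
  set K : ℝ := 2 * (n + 1) * 3 ^ (n + 1)
  have hc : 1 ≤ c := by
    have : (1 : ℝ) ≤ 2 ^ n := one_le_pow₀ (by norm_num)
    have h2 : (0 : ℝ) ≤ n := Nat.cast_nonneg _
    simp only [c]
    nlinarith
  have hK : 0 ≤ K := by positivity
  rcases hn.eq_or_lt with rfl | hn3
  · have hlog2 : 0 < Real.log 2 := Real.log_pos (by norm_num)
    have hlogc : 0 ≤ Real.log c := Real.log_nonneg hc
    refine ⟨K * c ^ 2 * (1 + (1 + Real.log c) / Real.log 2), by positivity, fun Q hQ => ?_⟩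
    have hlogQ : Real.log 2 ≤ Real.log Q := Real.log_le_log (by norm_num) hQ
    have h1 := card_reducibleBox_le (n := 2) (B := ⌊Q⌋₊) (by norm_num)
    set X : ℕ := 2 ^ 2 * (2 + 1) * ⌊Q⌋₊ with hXdef
    have hX : (X : ℝ) ≤ c * Q := by
      have : (⌊Q⌋₊ : ℝ) ≤ Q := Nat.floor_le (by linarith)
      rw [hXdef]; push_cast; simp only [c]; push_cast; linarith
    have hX0 : 1 ≤ X := by
      have : 1 ≤ ⌊Q⌋₊ := Nat.le_floor (by push_cast; linarith)
      omega
    have hX0' : (1 : ℝ) ≤ X := by exact_mod_cast hX0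
    refine h1.trans ?_
    simp only [Nat.reduceDiv, Finset.Icc_self, Finset.sum_singleton, Nat.reduceSub, Nat.reduceAdd,
      pow_one]
    rw [← Finset.mul_sum]
    have h2 : ∑ h ∈ Finset.Icc 1 X, (X : ℝ) ^ 2 / (h : ℝ) ≤ (c * Q) ^ 2 *
        (1 + Real.log c + Real.log Q) := by
      have h3 : Real.log X ≤ Real.log c + Real.log Q := by
        rw [← Real.log_mul (by linarith) (by linarith)]
        exact Real.log_le_log (by linarith) hX
      have h4 := sum_inv_Icc_le X
      simp only [div_eq_mul_one_div ((X : ℝ) ^ 2)]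
      rw [← Finset.mul_sum]
      refine mul_le_mul (by gcongr) (h4.trans (by linarith)) (by positivity) (by positivity)
    have h5 : 1 + Real.log c + Real.log Q ≤
        (1 + (1 + Real.log c) / Real.log 2) * Real.log Q := by
      have : 1 + Real.log c ≤ (1 + Real.log c) / Real.log 2 * Real.log Q := by
        rw [div_mul_eq_mul_div, le_div_iff₀ hlog2]
        gcongr
      linarith
    calc _ ≤ K * ((c * Q) ^ 2 * ((1 + (1 + Real.log c) / Real.log 2) * Real.log Q)) := by
          refine mul_le_mul_of_nonneg_left (h2.trans ?_) hK |>.trans_eq' ?_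
          · gcongr
          · simp [K]
      _ = _ := by simp only [ell, if_true, pow_one]; ring
  · set S : ℝ := ∑' h : ℕ, 1 / (h : ℝ) ^ 2
    have hsum : Summable fun h : ℕ => 1 / (h : ℝ) ^ 2 :=
      Real.summable_one_div_nat_pow.2 (by norm_num)
    have hS : 0 ≤ S := tsum_nonneg fun h => by positivity
    refine ⟨n * (K * (c ^ n * (S + 1))), by positivity, fun Q hQ => ?_⟩
    have h1 := card_reducibleBox_le (n := n) (B := ⌊Q⌋₊) (by omega)
    set X : ℕ := 2 ^ n * (n + 1) * ⌊Q⌋₊ with hXdef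
    have hX : (X : ℝ) ≤ c * Q := by
      have : (⌊Q⌋₊ : ℝ) ≤ Q := Nat.floor_le (by linarith)
      rw [hXdef]; push_cast; exact mul_le_mul_of_nonneg_left this (by positivity)
    have hX0 : 1 ≤ X := by
      have : 1 ≤ ⌊Q⌋₊ := Nat.le_floor (by push_cast; linarith)
      exact Nat.one_le_iff_ne_zero.2 (by positivity)
    have hX0' : (1 : ℝ) ≤ X := by exact_mod_cast hX0
    have hterm : ∀ d ∈ Finset.Icc 1 (n / 2), ∀ h ∈ Finset.Icc 1 X,
        (X : ℝ) ^ (n - d + 1) / (h : ℝ) ^ (n - d + 1 - d) ≤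
          (X : ℝ) ^ n * (1 / (h : ℝ) ^ 2) + X ^ (n - 1) := by
      intro d hd h hh
      rw [Finset.mem_Icc] at hd hh
      have hh1 : (1 : ℝ) ≤ h := by exact_mod_cast hh.1
      rcases hd.1.eq_or_lt with rfl | hd2
      · have : (X : ℝ) ^ (n - 1 + 1) / (h : ℝ) ^ (n - 1 + 1 - 1) ≤
            (X : ℝ) ^ n * (1 / (h : ℝ) ^ 2) := by
          rw [Nat.sub_add_cancel (by omega), mul_one_div]
          refine div_le_div_of_nonneg_left (by positivity) (by positivity) ?_
          exact pow_le_pow_right₀ hh1 (by omega)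
        have h0 : (0 : ℝ) ≤ X ^ (n - 1) := by positivity
        linarith
      · have : (X : ℝ) ^ (n - d + 1) / (h : ℝ) ^ (n - d + 1 - d) ≤ X ^ (n - 1) :=
          (div_le_self (by positivity) (one_le_pow₀ hh1)).trans
            (pow_le_pow_right₀ hX0' (by omega))
        have h0 : (0 : ℝ) ≤ (X : ℝ) ^ n * (1 / (h : ℝ) ^ 2) := by positivity
        linarith
    have hinner : ∀ d ∈ Finset.Icc 1 (n / 2), ∑ h ∈ Finset.Icc 1 X,
        K * ((X : ℝ) ^ (n - d + 1) / (h : ℝ) ^ (n - d + 1 - d)) ≤ K * ((X : ℝ) ^ n * (S + 1)) := by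
      intro d hd
      rw [← Finset.mul_sum]
      refine mul_le_mul_of_nonneg_left ((Finset.sum_le_sum (hterm d hd)).trans ?_) hK
      rw [Finset.sum_add_distrib, ← Finset.mul_sum, Finset.sum_const, Nat.card_Icc,
        Nat.add_sub_cancel, nsmul_eq_mul, mul_comm (X : ℝ) (X ^ (n - 1)), ← pow_succ,
        Nat.sub_add_cancel (by omega), mul_add, mul_one]
      have := hsum.sum_le_tsum (Finset.Icc 1 X) (fun h _ => by positivity)
      gcongr
    refine h1.trans ((Finset.sum_le_sum hinner).trans ?_)
    rw [Finset.sum_const, Nat.card_Icc, nsmul_eq_mul]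
    have he : ell n = 0 := if_neg (by omega)
    rw [he, pow_zero, mul_one]
    calc ((n / 2 + 1 - 1 : ℕ) : ℝ) * (K * ((X : ℝ) ^ n * (S + 1)))
        ≤ n * (K * ((c * Q) ^ n * (S + 1))) := by
          gcongr
          omega
      _ = _ := by rw [mul_pow]; ring

/-! ### The asymptotic formula -/

theorem exists_abs_remainder_le {n : ℕ} (hn : 2 ≤ n) :
    ∃ C : ℝ, ∀ Q : ℝ, 2 ≤ Q → ∀ I : Set ℝ, I.OrdConnected →
      |remainder n (density n) Q I| ≤ C * (Q ^ n * Real.log Q ^ ell n) := by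
  obtain ⟨C₁, h₁⟩ := exists_abs_primitiveCount_sub_le hn
  obtain ⟨C₂, hC₂, h₂⟩ := exists_card_reducibleBox_le hn
  have hlog2 : 0 < Real.log 2 := Real.log_pos (by norm_num)
  refine ⟨(n * 3 ^ n + |C₁|) / Real.log 2 ^ ell n + n * C₂, fun Q hQ I hI => ?_⟩
  have hQ0 : (0 : ℝ) < Q := by linarith
  have hlog : Real.log 2 ^ ell n ≤ Real.log Q ^ ell n :=
    pow_le_pow_left₀ hlog2.le (Real.log_le_log (by norm_num) hQ) _
  have hpow : 0 < Real.log 2 ^ ell n := pow_pos hlog2 _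
  -- Since `Q ≥ 2`, an error `O(Q ^ n)` is absorbed into the logarithmic bound at the cost of a
  -- power of `Real.log 2`.
  have hmain : ∀ D : ℝ, 0 ≤ D →
      D * Q ^ n ≤ D / Real.log 2 ^ ell n * (Q ^ n * Real.log Q ^ ell n) := fun D hD => by
    rw [div_mul_eq_mul_div, le_div_iff₀ hpow, mul_assoc]
    gcongr
  have h3 := h₁ I hI Q hQ0
  have h4 := abs_primitiveCount_sub_le hn hQ0.le I
  have h5 := h₂ Q hQ
  have hfl : (⌊Q⌋₊ : ℝ) ≤ Q := Nat.floor_le hQ0.le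
  have h6 : (2 * (⌊Q⌋₊ : ℝ) + 1) ^ n ≤ 3 ^ n * Q ^ n := by
    rw [← mul_pow]
    gcongr
    linarith
  set V := ∫ t in I, density n t
  set z := (riemannZeta ((n : ℂ) + 1)).re
  have h7 : 2 * remainder n (density n) Q I =
      (primitiveCount n ⌊Q⌋₊ I - Q ^ (n + 1) / z * V) -
        (primitiveCount n ⌊Q⌋₊ I - 2 * count n Q I) := by
    have : Q ^ (n + 1) / z = 2 * (Q ^ (n + 1) / (2 * z)) := by rw [mul_comm 2 z, ← div_div]; ring
    simp only [remainder, this]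
    ring
  have h8 : 2 * |remainder n (density n) Q I| ≤ C₁ * Q ^ n +
      n * (3 ^ n * Q ^ n + C₂ * (Q ^ n * Real.log Q ^ ell n)) := by
    have : 2 * |remainder n (density n) Q I| = |2 * remainder n (density n) Q I| := by
      rw [abs_mul, abs_two]
    rw [this, h7]
    refine (abs_sub _ _).trans (add_le_add h3 (h4.trans ?_))
    gcongr
  have h9 := hmain (n * 3 ^ n + |C₁|) (by positivity)
  have h10 : C₁ * Q ^ n ≤ |C₁| * Q ^ n := by gcongr; exact le_abs_self _
  have h11 := abs_nonneg (remainder n (density n) Q I)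
  linarith

/-! ### The distribution function -/

theorem count_eq_remainder_add (n : ℕ) (Q : ℝ) (I : Set ℝ) :
    (count n Q I : ℝ) = remainder n (density n) Q I +
      Q ^ (n + 1) / (2 * (riemannZeta ((n : ℂ) + 1)).re) * ∫ x in I, density n x := by
  rw [remainder]; ring

theorem tendsto_count_div {n : ℕ} (hn : 2 ≤ n) {I : Set ℝ} (hI : I.OrdConnected) :
    Tendsto (fun Q : ℝ => (count n Q I : ℝ) / Q ^ (n + 1)) atTop
      (𝓝 ((∫ x in I, density n x) / (2 * (riemannZeta ((n : ℂ) + 1)).re))) := by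
  obtain ⟨C, hC⟩ := exists_abs_remainder_le hn
  have h1 : Tendsto (fun Q : ℝ => C * (Real.log Q ^ ell n / (1 * Q + 0))) atTop (𝓝 0) := by
    simpa using (Real.tendsto_pow_log_div_mul_add_atTop 1 0 (ell n) one_ne_zero).const_mul C
  have h2 : Tendsto (fun Q : ℝ => remainder n (density n) Q I / Q ^ (n + 1)) atTop (𝓝 0) := by
    refine squeeze_zero_norm' ?_ h1
    filter_upwards [eventually_ge_atTop (2 : ℝ)] with Q hQ
    have hQ0 : 0 < Q := by linarith
    rw [Real.norm_eq_abs, abs_div, abs_of_pos (pow_pos hQ0 _), div_le_iff₀ (pow_pos hQ0 _)]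
    refine (hC Q hQ I hI).trans_eq ?_
    rw [pow_succ]
    field_simp
    ring
  have h3 := h2.add_const ((∫ x in I, density n x) / (2 * (riemannZeta ((n : ℂ) + 1)).re))
  rw [zero_add] at h3
  refine h3.congr' ?_
  filter_upwards [eventually_gt_atTop (0 : ℝ)] with Q hQ
  rw [count_eq_remainder_add, add_div]
  congr 1
  field_simp

theorem integral_density_pos {n : ℕ} (hn : 1 ≤ n) : 0 < ∫ x, density n x :=
  integral_pos_of_integrable_nonneg_nonzero (x := 0) (continuous_density n) (integrable_density hn)
    (fun x => density_nonneg x) (density_pos hn 0).ne'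

theorem tendsto_count_div_count {n : ℕ} (hn : 2 ≤ n) (x : ℝ) :
    Tendsto (fun Q : ℝ => (count n Q (Set.Iic x) : ℝ) / (count n Q Set.univ : ℝ)) atTop
      (𝓝 ((∫ y in Set.Iic x, density n y) / ∫ y, density n y)) := by
  have hz := zeta_re_ne_zero (n := n) (by omega)
  have hpos := integral_density_pos (n := n) (by omega)
  have h1 := tendsto_count_div hn (Set.ordConnected_Iic (a := x))
  have h2 := tendsto_count_div hn Set.ordConnected_univ
  rw [setIntegral_univ] at h2
  have h3 := h1.div h2 (div_ne_zero hpos.ne' (mul_ne_zero two_ne_zero hz))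
  rw [div_div_div_cancel_right₀ (mul_ne_zero two_ne_zero hz)] at h3
  refine h3.congr' ?_
  filter_upwards [eventually_gt_atTop (0 : ℝ)] with Q hQ
  simp only [Pi.div_apply]
  rw [div_div_div_cancel_right₀ (pow_pos hQ _).ne']

theorem hasDerivAt_integral_Iic {n : ℕ} (hn : 1 ≤ n) (x : ℝ) :
    HasDerivAt (fun x => (∫ y in Set.Iic x, density n y) / ∫ y, density n y)
      (density n x / ∫ y, density n y) x := by
  refine HasDerivAt.div_const ?_ _
  have hint := integrable_density hn
  have h1 : (fun x => ∫ y in Set.Iic x, density n y) =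
      fun x => (∫ y in Set.Iic 0, density n y) + ∫ y in (0 : ℝ)..x, density n y := by
    ext x
    rw [← intervalIntegral.integral_Iic_sub_Iic hint.integrableOn hint.integrableOn]
    ring
  rw [h1]
  exact (intervalIntegral.integral_hasDerivAt_right hint.intervalIntegrable
    ((continuous_density n).stronglyMeasurableAtFilter _ _)
    (continuous_density n).continuousAt).const_add _

theorem contDiff_one_integral_Iic {n : ℕ} (hn : 1 ≤ n) :
    ContDiff ℝ 1 fun x => (∫ y in Set.Iic x, density n y) / ∫ y, density n y := by
  rw [contDiff_one_iff_deriv]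
  refine ⟨fun x => (hasDerivAt_integral_Iic hn x).differentiableAt, ?_⟩
  rw [funext fun x => (hasDerivAt_integral_Iic hn x).deriv]
  exact (continuous_density n).div_const _

/-! ### Gaps around rational numbers -/

theorem abs_tailEval_sub_le {n : ℕ} {q : Fin n → ℝ} {Q T x y : ℝ} (hq : ∀ k, |q k| ≤ Q)
    (hx : |x| ≤ T) (hy : |y| ≤ T) :
    |tailEval q x - tailEval q y| ≤
      Q * (∑ k : Fin n, ((k : ℝ) + 1) * T ^ (k : ℕ)) * |x - y| :=
  (convex_Icc (-T) T).norm_image_sub_le_of_norm_hasDerivWithin_le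
    (fun t _ => (hasDerivAt_tailEval q t).hasDerivWithinAt)
    (fun _ ht => abs_tailDeriv_le hq (abs_le.2 ht)) (abs_le.1 hy) (abs_le.1 hx)

/-- Otherwise `p` would be a minimal polynomial of the rational `x`, which is already a root of a
linear polynomial. -/
theorem eval_rat_ne_zero {p : ℤ[X]} {α : ℝ} (hp : IsMinimalPolynomial p α)
    (hd : 2 ≤ p.natDegree) (x : ℚ) : aeval (x : ℝ) p ≠ 0 := fun h => by
  have hx := isMinimalPolynomial_of_irreducible hp.irreducible (by omega) h
  have hden : (x.den : ℤ) ≠ 0 := by exact_mod_cast x.den_nz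
  have h1 : (C (x.den : ℤ) * X + C (-x.num)).natDegree = 1 := natDegree_linear hden
  have h0 : C (x.den : ℤ) * X + C (-x.num) ≠ 0 := fun h0 => by
    rw [h0, natDegree_zero] at h1; omega
  have h2 := hx.2.2.1 _ h0 (by
    have : (x : ℝ) = x.num / x.den := by exact_mod_cast (Rat.num_div_den x).symm
    have hden' : (x.den : ℝ) ≠ 0 := by exact_mod_cast x.den_nz
    simp [this]
    field_simp
    ring)
  omega

/-- Liouville's argument: with `b` the denominator of `x`, the nonzero integer `b ^ n * p(x)` has
absolute value at least `1`, while the mean value theorem gives `|p(x)| ≤ Q * D * |x - α|` for a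
root `α` near `x`. -/
theorem exists_gap {n : ℕ} (hn : 2 ≤ n) (x : ℚ) :
    ∃ c : ℝ, 0 < c ∧ c ≤ 1 ∧ ∀ Q : ℝ, 0 ≤ Q →
      count n Q (Set.Icc (x - c / (|Q| + 1)) (x + c / (|Q| + 1))) = 0 := by
  set T : ℝ := |(x : ℝ)| + 1
  set D : ℝ := ∑ k : Fin n, ((k : ℝ) + 1) * T ^ (k : ℕ)
  have hT : 0 ≤ T := by positivity
  have hD : 0 ≤ D := by positivity
  have hden : (1 : ℝ) ≤ x.den := by exact_mod_cast x.den_pos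
  have hb : (1 : ℝ) ≤ (x.den : ℝ) ^ n := one_le_pow₀ hden
  refine ⟨1 / ((x.den : ℝ) ^ n * (D + 1)), by positivity, ?_, fun Q hQ => ?_⟩
  · exact div_le_one_of_le₀ (one_le_mul_of_one_le_of_one_le hb (by linarith)) (by positivity)
  -- Taking `D + 1` here, and `Q + 1` in the radius, makes the final inequality `Q * D < (Q + 1) *
  -- (D + 1)` strict.
  set c : ℝ := 1 / ((x.den : ℝ) ^ n * (D + 1)) with hc
  have hc0 : 0 < c := by positivity
  have hc1 : c ≤ 1 :=
    div_le_one_of_le₀ (one_le_mul_of_one_le_of_one_le hb (by linarith)) (by positivity)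
  rw [count, Set.ncard_eq_zero ((finite_algebraicNumbers n Q).inter_of_left _),
    Set.eq_empty_iff_forall_notMem]
  rintro α ⟨⟨p, hp, hd, hh⟩, hα⟩
  rw [abs_of_nonneg hQ] at hα
  have hQ1 : 0 < Q + 1 := by linarith
  have hdist : |(x : ℝ) - α| ≤ c / (Q + 1) := by
    rw [abs_le]; constructor <;> linarith [hα.1, hα.2]
  have hdist1 : |(x : ℝ) - α| ≤ 1 :=
    hdist.trans ((div_le_self hc0.le (by linarith)).trans hc1)
  have hαT : |α| ≤ T := by
    have := abs_sub_abs_le_abs_sub α (x : ℝ)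
    rw [abs_sub_comm] at this
    simp only [T]; linarith
  let q : Fin n → ℝ := fun k => (p.coeff ((k : ℕ) + 1) : ℝ)
  have hq : ∀ k, |q k| ≤ Q := fun k => by
    have h1 := natAbs_coeff_le_height p ((k : ℕ) + 1)
    have h2 : ((p.coeff ((k : ℕ) + 1)).natAbs : ℝ) ≤ height p := by exact_mod_cast h1
    rw [Nat.cast_natAbs, Int.cast_abs] at h2
    exact h2.trans hh
  have hev : ∀ t : ℝ, aeval t p = p.coeff 0 + tailEval q t := fun t => by
    have h1 : ofCoeffs (fun i : Fin (n + 1) => p.coeff i) = p := ofCoeffs_coeff hd.le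
    conv_lhs => rw [← h1]
    rw [aeval_ofCoeffs_eq, eval_ofCoeffs]
    simp [Fin.sum_univ_succ, intVec, tailEval, q]
  have h1 : (1 : ℝ) ≤ (x.den : ℝ) ^ n * |aeval (x : ℝ) p| := by
    have hx : ((x.num : ℤ) : ℝ) / ((x.den : ℤ) : ℝ) = x := by exact_mod_cast Rat.num_div_den x
    have h2 := one_le_pow_mul_abs_eval_div (K := ℝ) (f := p) (a := x.num) (b := x.den)
      (by exact_mod_cast x.den_pos)
    rw [hx, eval_map_algebraMap, hd] at h2
    exact_mod_cast h2 (eval_rat_ne_zero hp (by omega) x)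
  have h2 : |aeval (x : ℝ) p| ≤ Q * D * |(x : ℝ) - α| := by
    have h3 := abs_tailEval_sub_le hq (x := (x : ℝ)) (y := α) (T := T) (by simp [T]) hαT
    have h4 : aeval (x : ℝ) p = tailEval q x - tailEval q α := by
      have := hev α
      rw [hp.2.1] at this
      rw [hev]; linarith
    rwa [h4]
  have h3 : (x.den : ℝ) ^ n * |aeval (x : ℝ) p| ≤
      (x.den : ℝ) ^ n * (Q * D * (c / (Q + 1))) := by
    refine mul_le_mul_of_nonneg_left (h2.trans ?_) (by positivity)
    gcongr
  have h4 : (x.den : ℝ) ^ n * (Q * D * (c / (Q + 1))) = (Q * D) / ((Q + 1) * (D + 1)) := by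
    rw [hc]; field_simp
  have h5 : (Q * D) / ((Q + 1) * (D + 1)) < 1 := by
    rw [div_lt_one (by positivity)]
    nlinarith
  linarith

/-- On the gap the count is `0`, so the remainder is minus the main term: `Q ^ (n + 1)` times an
integral over length `2 * c / (Q + 1)` of a density bounded above and away from `0` near `x`. -/
theorem exists_remainder_order {n : ℕ} (hn : 2 ≤ n) (x : ℚ) :
    ∃ r : ℝ → ℝ, (∀ Q, 0 < r Q) ∧ ∃ c₁ c₂ : ℝ, 0 < c₁ ∧ 0 < c₂ ∧
      ∀ᶠ Q : ℝ in atTop,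
        c₁ * Q ^ n ≤ |remainder n (density n) Q (Set.Icc (x - r Q) (x + r Q))| ∧
        |remainder n (density n) Q (Set.Icc (x - r Q) (x + r Q))| ≤ c₂ * Q ^ n := by
  obtain ⟨c, hc0, hc1, hgap⟩ := exists_gap hn x
  have hcont := (continuous_density n).continuousOn (s := Set.Icc ((x : ℝ) - 1) (x + 1))
  have hne : (Set.Icc ((x : ℝ) - 1) (x + 1)).Nonempty := ⟨x, by constructor <;> linarith⟩
  obtain ⟨a, -, ha⟩ := isCompact_Icc.exists_isMinOn hne hcont
  obtain ⟨b, -, hb⟩ := isCompact_Icc.exists_isMaxOn hne hcont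
  have hm : 0 < density n a := density_pos (by omega) a
  have hM : 0 < density n b := density_pos (by omega) b
  have hz := abs_pos.2 (zeta_re_ne_zero (n := n) (by omega))
  set z := |(riemannZeta ((n : ℂ) + 1)).re|
  -- The absolute value in `|Q| + 1` keeps the radius positive for every real `Q`, not only for
  -- large ones.
  refine ⟨fun Q => c / (|Q| + 1), fun Q => by positivity, density n a * c / (2 * z),
    density n b * c / z, by positivity, by positivity, ?_⟩
  filter_upwards [eventually_ge_atTop (1 : ℝ)] with Q hQ
  have hQ0 : 0 < Q := by linarith
  set r := c / (|Q| + 1) with hr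
  have hr0 : 0 < r := by positivity
  have hr1 : r ≤ 1 := (div_le_self hc0.le (by linarith [abs_nonneg Q])).trans hc1
  set J := Set.Icc ((x : ℝ) - r) (x + r)
  have hJ : J ⊆ Set.Icc ((x : ℝ) - 1) (x + 1) := Set.Icc_subset_Icc (by linarith) (by linarith)
  have hvol : volume.real J = 2 * r := by
    simp only [J]
    rw [Real.volume_real_Icc_of_le (by linarith)]; ring
  have hint : IntegrableOn (density n) J := (integrable_density (by omega)).integrableOn
  have hfin : volume J ≠ ⊤ := isCompact_Icc.measure_lt_top.ne
  have hconst : ∀ d : ℝ, ∫ _ in J, d = d * (2 * r) := fun d => by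
    rw [setIntegral_const, hvol, smul_eq_mul, mul_comm]
  have hlow : density n a * (2 * r) ≤ ∫ t in J, density n t := by
    rw [← hconst]
    exact setIntegral_mono_on (integrableOn_const hfin) hint measurableSet_Icc
      fun t ht => ha (hJ ht)
  have hup : ∫ t in J, density n t ≤ density n b * (2 * r) := by
    rw [← hconst]
    exact setIntegral_mono_on hint (integrableOn_const hfin) measurableSet_Icc
      fun t ht => hb (hJ ht)
  have hV : 0 ≤ ∫ t in J, density n t := integral_nonneg fun t => density_nonneg t
  have hrem : |remainder n (density n) Q J| = Q ^ (n + 1) / (2 * z) * ∫ t in J, density n t := by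
    rw [remainder, hgap Q hQ0.le, Nat.cast_zero, zero_sub, abs_neg, abs_mul, abs_of_nonneg hV,
      abs_div, abs_mul, abs_two, abs_of_pos (pow_pos hQ0 _)]
  have hrQ : r = c / (Q + 1) := by rw [hr, abs_of_pos hQ0]
  have hQn := pow_pos hQ0 n
  rw [hrem]
  constructor
  · calc density n a * c / (2 * z) * Q ^ n
        ≤ Q ^ (n + 1) / (2 * z) * (density n a * (2 * r)) := by
          have h1 : 1 ≤ Q * (2 / (Q + 1)) := by
            rw [mul_div_assoc', le_div_iff₀ (by linarith)]; linarith
          have h2 : Q ^ (n + 1) / (2 * z) * (density n a * (2 * r)) =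
              density n a * c / (2 * z) * Q ^ n * (Q * (2 / (Q + 1))) := by
            rw [hrQ, pow_succ]; ring
          rw [h2]
          exact le_mul_of_one_le_right (by positivity) h1
      _ ≤ _ := by gcongr
  · calc _ ≤ Q ^ (n + 1) / (2 * z) * (density n b * (2 * r)) := by gcongr
      _ ≤ density n b * c / z * Q ^ n := by
          have h1 : Q * (1 / (Q + 1)) ≤ 1 := by
            rw [mul_one_div, div_le_one (by linarith)]; linarith
          have h2 : Q ^ (n + 1) / (2 * z) * (density n b * (2 * r)) =
              density n b * c / z * Q ^ n * (Q * (1 / (Q + 1))) := by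
            rw [hrQ, pow_succ]; field_simp
          rw [h2]
          exact mul_le_of_le_one_right (by positivity) h1

end RealAlgebraic

end

theorem theorem1 (n : ℕ) (hn : 2 ≤ n) :
    ∃ φ : ℝ → ℝ,
      Continuous φ ∧ (∀ x, 0 < φ x) ∧ Integrable φ ∧
      -- the asymptotic formula, uniformly in all intervals (bounded or not)
      (∃ C : ℝ, ∀ Q : ℝ, 2 ≤ Q → ∀ I : Set ℝ, I.OrdConnected →
        |RealAlgebraic.remainder n φ Q I| ≤ C * (Q ^ n * Real.log Q ^ RealAlgebraic.ell n)) ∧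
      -- infinitely many intervals (one for every rational midpoint) with remainder of order `Q ^ n`
      (∀ x₀ : ℚ, ∃ r : ℝ → ℝ, (∀ Q, 0 < r Q) ∧ ∃ c₁ c₂ : ℝ, 0 < c₁ ∧ 0 < c₂ ∧
        ∀ᶠ Q : ℝ in atTop,
          c₁ * Q ^ n ≤ |RealAlgebraic.remainder n φ Q (Set.Icc (x₀ - r Q) (x₀ + r Q))| ∧
          |RealAlgebraic.remainder n φ Q (Set.Icc (x₀ - r Q) (x₀ + r Q))| ≤ c₂ * Q ^ n) ∧
      (∀ x, φ (-x) = φ x) ∧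
      (∀ x, x ≠ 0 → x ^ 2 * φ x = φ (1 / x)) ∧
      (∀ t, φ t = ∫ p in RealAlgebraic.region n t,
        |∑ k : Fin n, ((k : ℝ) + 1) * p k * t ^ (k : ℕ)|) ∧
      -- the distribution function exists and is continuously differentiable
      (∃ F : ℝ → ℝ,
        (∀ x, Tendsto (fun Q : ℝ => (RealAlgebraic.count n Q (Set.Iic x) : ℝ) /
          (RealAlgebraic.count n Q Set.univ : ℝ)) atTop (𝓝 (F x))) ∧
        ContDiff ℝ 1 F ∧
        ∀ x, HasDerivAt F (φ x / ∫ y, φ y) x) := by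
  have hn1 : 1 ≤ n := by omega
  exact ⟨RealAlgebraic.density n, RealAlgebraic.continuous_density n,
    RealAlgebraic.density_pos hn1, RealAlgebraic.integrable_density hn1,
    RealAlgebraic.exists_abs_remainder_le hn, RealAlgebraic.exists_remainder_order hn,
    RealAlgebraic.density_neg, fun _ => RealAlgebraic.density_inv hn1,
    RealAlgebraic.density_eq n, _, RealAlgebraic.tendsto_count_div_count hn,
    RealAlgebraic.contDiff_one_integral_Iic hn1, RealAlgebraic.hasDerivAt_integral_Iic hn1⟩
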